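/- Let $q\in\mathbb{C}^*$ with $|q|\neq 1$, and let $\mathcal{M}er(\mathbb{C}^*)$ be the field of meromorphic functions on $\mathbb{C}^*=\mathbb{C}\setminus\{0\}$, equipped with the automorphism $\sigma_q: f(z)\mapsto f(qz)$ and the derivation $\partial = z\,\frac{d}{dz}$. Let $C_E=\{h\in\mathcal{M}er(\mathbb{C}^*) : \sigma_q(h)=h\}$ and let $C_E(z)$ be the compositum of $C_E$ and $\mathbb{C}(z)$ in $\mathcal{M}er(\mathbb{C}^*)$. **Theorem.** Let $a\in\mathbb{C}(z)^*$ and let $f\in\mathcal{M}er(\mathbb{C}^*)$ be a nonzero solution of the $q$-difference equation $\sigma_q(f)=af$. Then: 1. $f$ and $\partial f$ are algebraically dependent over $C_E(z)$ if and only if $a$ is of the form $\mu\,\sigma_q(g)/g$ with $\mu\in\mathbb{C}^*$ and $g\in\mathbb{C}(z)^*$. 2. $f$, $\partial f$ and $\partial^2 f$ are algebraically dependent over $C_E(z)$ if and only if $a$ is of the form $\mu z^r\,\sigma_q(g)/g$ with $\mu\in\mathbb{C}^*$, $r\in\mathbb{Z}$ and $g\in\mathbb{C}(z)^*$. 3.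 In all other cases (that is, when $a$ has neither of these two forms), $f$ is hypertranscendental over $C_E(z)$: the functions $f,\partial f,\partial^2 f,\dots$ are algebraically independent over $C_E(z)$. -/

import Mathlib

open Filter Topology

noncomputable section

namespace QDiff

/-- The `ℂ`-algebra of functions `ℂ → ℂ` that are meromorphic at every point of `ℂ \ {0}`.
(The value at `0`, and the values at the points of a discrete closed subset of `ℂ \ {0}`, are
irrelevant and are divided out below.) -/
def MerFun : Subalgebra ℂ (ℂ → ℂ) where
  carrier := {f | MeromorphicOn f {0}ᶜ}
  mul_mem' hf hg := MeromorphicOn.mul hf hg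
  add_mem' hf hg := MeromorphicOn.add hf hg
  algebraMap_mem' c := MeromorphicOn.const c

/-- The ideal of functions that vanish on `ℂ \ {0}` outside a subset without accumulation point
in `ℂ \ {0}`. -/
def MerNull : Ideal MerFun where
  carrier := {f | ∀ x : ℂ, x ≠ 0 → ∀ᶠ y in 𝓝[≠] x, (f : ℂ → ℂ) y = 0}
  add_mem' {f g} hf hg x hx := by
    filter_upwards [hf x hx, hg x hx] with y h1 h2
    simp [h1, h2]
  zero_mem' x _ := by simp
  smul_mem' c f hf x hx := by
    filter_upwards [hf x hx] with y h1
    simp [h1]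

/-- `ℳer(ℂ*)`: meromorphic functions on `ℂ \ {0}`, two of them being identified when they agree
outside a subset without accumulation point in `ℂ \ {0}`. -/
def Mer : Type := MerFun ⧸ MerNull

instance : CommRing Mer := inferInstanceAs (CommRing (MerFun ⧸ MerNull))

instance : Algebra ℂ Mer := inferInstanceAs (Algebra ℂ (MerFun ⧸ MerNull))

/-- The element of `ℳer(ℂ*)` represented by a function. -/
def mk : MerFun →ₐ[ℂ] Mer := (Ideal.Quotient.mkₐ ℂ MerNull : MerFun →ₐ[ℂ] MerFun ⧸ MerNull)

theorem mk_surjective : Function.Surjective mk := Ideal.Quotient.mk_surjective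

theorem mk_eq_mk {f g : MerFun} :
    mk f = mk g ↔ ∀ x : ℂ, x ≠ 0 → ∀ᶠ y in 𝓝[≠] x, (f : ℂ → ℂ) y = (g : ℂ → ℂ) y := by
  have h : mk f = mk g ↔ f - g ∈ MerNull := Ideal.Quotient.eq
  rw [h]
  refine forall₂_congr fun x _ => eventually_congr (Eventually.of_forall fun y => ?_)
  simp [sub_eq_zero]

theorem mk_eq_zero {f : MerFun} :
    mk f = 0 ↔ ∀ x : ℂ, x ≠ 0 → ∀ᶠ y in 𝓝[≠] x, (f : ℂ → ℂ) y = 0 := by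
  rw [← map_zero mk, mk_eq_mk]
  rfl

/-- A representative of an element of `ℳer(ℂ*)`. -/
def rep (φ : Mer) : MerFun := (mk_surjective φ).choose

theorem mk_rep (φ : Mer) : mk (rep φ) = φ := (mk_surjective φ).choose_spec

/-- The pointwise inverse `1 / f`. -/
def invFun (f : MerFun) : MerFun := ⟨(f : ℂ → ℂ)⁻¹, MeromorphicOn.inv f.2⟩

/-- `ℳer(ℂ*)` is a field, because `ℂ \ {0}` is connected. -/
theorem mk_mul_mk_invFun {f : MerFun} (hf : mk f ≠ 0) : mk f * mk (invFun f) = 1 := by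
  have hconn : IsConnected ({0}ᶜ : Set ℂ) :=
    isConnected_compl_singleton_of_one_lt_rank (by simp) 0
  have hmer : MeromorphicOn (f : ℂ → ℂ) {0}ᶜ := f.2
  have hne : ∃ x ∈ ({0}ᶜ : Set ℂ), meromorphicOrderAt (f : ℂ → ℂ) x ≠ ⊤ := by
    by_contra! hcon
    exact hf (mk_eq_zero.2 fun x hx => meromorphicOrderAt_eq_top_iff.1 (hcon x hx))
  have hall := (hmer.exists_meromorphicOrderAt_ne_top_iff_forall_mem hconn).1 hne
  rw [← map_mul, ← map_one mk, mk_eq_mk]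
  intro x hx
  filter_upwards [(meromorphicOrderAt_ne_top_iff_eventually_ne_zero (hmer x hx)).1 (hall x hx)]
    with y hy
  simp [invFun, hy]

instance : Field Mer where
  inv φ := mk (invFun (rep φ))
  exists_pair_ne := by
    refine ⟨0, 1, fun h => ?_⟩
    obtain ⟨y, hy⟩ := (mk_eq_zero.1 ((map_one mk).trans h.symm) 1 one_ne_zero).exists
    simp at hy
  mul_inv_cancel φ hφ := by
    have h := mk_mul_mk_invFun (f := rep φ) (by rwa [mk_rep])
    rwa [mk_rep] at h
  inv_zero := by
    rw [mk_eq_zero]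
    intro x hx
    filter_upwards [mk_eq_zero.1 (mk_rep 0) x hx] with y hy
    simp [invFun, hy]
  nnqsmul := _
  qsmul := _

/-- The coordinate function `z`. -/
def z : Mer := mk ⟨id, MeromorphicOn.id⟩

/-- `f(z) ↦ f(qz)` on representatives. -/
def dilateFun (q : ℂˣ) : MerFun →ₐ[ℂ] MerFun where
  toFun f := ⟨fun x => (f : ℂ → ℂ) ((q : ℂ) * x), fun x hx => by
    have h : MeromorphicAt (f : ℂ → ℂ) ((q : ℂ) * x) := f.2 _ (mul_ne_zero q.ne_zero hx)
    exact h.comp_analyticAt (g := fun y => (q : ℂ) * y) (by fun_prop)⟩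
  map_one' := rfl
  map_mul' _ _ := rfl
  map_zero' := rfl
  map_add' _ _ := rfl
  commutes' _ := rfl

theorem dilateFun_mem (q : ℂˣ) : MerNull ≤ MerNull.comap (dilateFun q) := by
  intro f hf x hx
  have h := hf ((q : ℂ) * x) (mul_ne_zero q.ne_zero hx)
  have ht : Tendsto (fun y : ℂ => (q : ℂ) * y) (𝓝[≠] x) (𝓝[≠] ((q : ℂ) * x)) := by
    refine tendsto_nhdsWithin_of_tendsto_nhds_of_eventually_within _ ?_ ?_
    · exact ((continuous_const.mul continuous_id).tendsto x).mono_left nhdsWithin_le_nhds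
    · filter_upwards [self_mem_nhdsWithin] with y hy
      simpa using hy
  exact ht.eventually h

/-- `f(z) ↦ f(qz)` as an endomorphism of `ℳer(ℂ*)`. -/
def dilate (q : ℂˣ) : Mer →ₐ[ℂ] Mer :=
  (Ideal.quotientMapₐ MerNull (dilateFun q) (dilateFun_mem q) :
    MerFun ⧸ MerNull →ₐ[ℂ] MerFun ⧸ MerNull)

theorem dilate_mk (q : ℂˣ) (f : MerFun) : dilate q (mk f) = mk (dilateFun q f) := rfl

theorem dilate_comp (p q : ℂˣ) (h : q * p = 1) :
    (dilate p).comp (dilate q) = AlgHom.id ℂ Mer := by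
  ext φ
  obtain ⟨f, rfl⟩ := mk_surjective φ
  have h' : (q : ℂ) * p = 1 := by rw [← Units.val_mul, h, Units.val_one]
  have h2 : dilateFun p (dilateFun q f) = f := by
    apply Subtype.ext
    funext x
    change (f : ℂ → ℂ) ((q : ℂ) * ((p : ℂ) * x)) = (f : ℂ → ℂ) x
    rw [← mul_assoc, h', one_mul]
  simp [dilate_mk, h2]

/-- The automorphism `σ_q : f(z) ↦ f(qz)` of `ℳer(ℂ*)`. -/
def sigma (q : ℂˣ) : Mer ≃ₐ[ℂ] Mer :=
  AlgEquiv.ofAlgHom (dilate q) (dilate q⁻¹)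
    (dilate_comp _ _ (by simp)) (dilate_comp _ _ (by simp))

theorem sigma_mk (q : ℂˣ) (f : MerFun) : sigma q (mk f) = mk (dilateFun q f) := rfl

/-- `z · df/dz` on representatives. -/
def eulerFun (f : MerFun) : MerFun :=
  ⟨fun x => x * deriv (f : ℂ → ℂ) x,
    MeromorphicOn.mul MeromorphicOn.id (MeromorphicOn.deriv f.2)⟩

theorem eulerFun_congr {f g : MerFun} (h : mk f = mk g) :
    mk (eulerFun f) = mk (eulerFun g) := by
  rw [mk_eq_mk] at h ⊢
  intro x hx
  filter_upwards [eventually_eventually_nhdsWithin.2 (h x hx), self_mem_nhdsWithin] with y hy hyx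
  have h3 : (f : ℂ → ℂ) =ᶠ[𝓝 y] (g : ℂ → ℂ) := by
    rwa [(isOpen_compl_singleton.mem_nhds hyx |> nhdsWithin_eq_nhds.2)] at hy
  simp [eulerFun, h3.deriv_eq]

theorem eventually_differentiableAt (f : MerFun) {x : ℂ} (hx : x ≠ 0) :
    ∀ᶠ y in 𝓝[≠] x, DifferentiableAt ℂ (f : ℂ → ℂ) y := by
  have h : MeromorphicAt (f : ℂ → ℂ) x := f.2 x hx
  filter_upwards [h.eventually_analyticAt] with y hy using hy.differentiableAt

/-- `z · d/dz` as a map of `ℳer(ℂ*)` to itself. -/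
def euler (φ : Mer) : Mer := mk (eulerFun (rep φ))

theorem euler_mk (f : MerFun) : euler (mk f) = mk (eulerFun f) :=
  eulerFun_congr (mk_rep (mk f))

/-- The derivation `∂ = z · d/dz` of `ℳer(ℂ*)`. -/
def del : Derivation ℂ Mer Mer :=
  Derivation.mk'
    { toFun := euler
      map_add' := fun φ ψ => by
        obtain ⟨f, rfl⟩ := mk_surjective φ
        obtain ⟨g, rfl⟩ := mk_surjective ψ
        rw [← map_add, euler_mk, euler_mk, euler_mk, ← map_add, mk_eq_mk]
        intro x hx
        filter_upwards [eventually_differentiableAt f hx, eventually_differentiableAt g hx]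
          with y hf hg
        simp [eulerFun, deriv_add hf hg, mul_add]
      map_smul' := fun c φ => by
        obtain ⟨f, rfl⟩ := mk_surjective φ
        rw [← map_smul, euler_mk, euler_mk, RingHom.id_apply, ← map_smul, mk_eq_mk]
        intro x hx
        filter_upwards [eventually_differentiableAt f hx] with y hf
        simp [eulerFun, deriv_const_smul c hf, mul_left_comm] }
    (fun φ ψ => by
      obtain ⟨f, rfl⟩ := mk_surjective φ
      obtain ⟨g, rfl⟩ := mk_surjective ψ
      change euler _ = _ * euler _ + _ * euler _
      rw [← map_mul, euler_mk, euler_mk, euler_mk, ← map_mul, ← map_mul, ← map_add, mk_eq_mk]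
      intro x hx
      filter_upwards [eventually_differentiableAt f hx, eventually_differentiableAt g hx]
        with y hf hg
      simp [eulerFun, deriv_mul hf hg]
      ring)

theorem del_mk (f : MerFun) : del (mk f) = mk (eulerFun f) := euler_mk f

/-- `ℂ(z)`, as a subfield of `ℳer(ℂ*)`. -/
def K : IntermediateField ℂ Mer := IntermediateField.adjoin ℂ {z}

/-- `C_E`, the subfield of the `σ_q`-invariant elements of `ℳer(ℂ*)`. -/
def CE (q : ℂˣ) : IntermediateField ℂ Mer where
  carrier := {f | sigma q f = f}
  mul_mem' {f g} hf hg := by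
    simp only [Set.mem_ofPred_eq] at hf hg ⊢
    rw [map_mul, hf, hg]
  add_mem' {f g} hf hg := by
    simp only [Set.mem_ofPred_eq] at hf hg ⊢
    rw [map_add, hf, hg]
  algebraMap_mem' c := (sigma q).commutes c
  inv_mem' f hf := by
    simp only [Set.mem_ofPred_eq] at hf ⊢
    rw [map_inv₀, hf]

/-- `C_E(z)`, the compositum of `C_E` and `ℂ(z)` in `ℳer(ℂ*)`. -/
def KE (q : ℂˣ) : IntermediateField ℂ Mer := CE q ⊔ K

/-- `f` is hypertranscendental over the subfield `L`: no non-zero polynomial with coefficients in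
`L` vanishes at finitely many of the derivatives `f, ∂f, ∂²f, …`. -/
def Hypertranscendental (L : IntermediateField ℂ Mer) (f : Mer) : Prop :=
  AlgebraicIndependent L (fun n : ℕ => del^[n] f)

end QDiff

end

/-! Write y = ∂f/f and b = ∂a/a. Taking logarithmic derivatives turns σf = af into σy = y + b, and
since σ commutes with ∂, σ(∂ⁱy) = ∂ⁱy + ∂ⁱb. The families f, ∂f, …, ∂ᴺf and f, y, …, ∂ᴺ⁻¹y are
related by a triangular change of generators, so a dependence among the former is one among the
latter. If y, …, ∂ᴺ⁻¹y are already dependent, an additive Ostrowski argument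
(`exists_linear_of_not_algebraicIndependent`) gives Σ lᵢ ∂ⁱb = σv - v with lᵢ in C_E not all zero
and v in C_E(z). Otherwise f is algebraic over them, and `exists_of_not_transcendental` gives σ(c)
aʲ = c aᵏ with j ≠ k, whose logarithmic derivative is a relation of the same kind. So dependence
always produces a telescoper for b (`hasTelescoper_of_not_algebraicIndepOn`).

Telescopers are excluded by poles. Up to a factor μ zʳ σ(g)/g, a is a product of (z - β)^(n β) with
the β nonzero and in distinct q-orbits (`hasNormalForm_of_mem_K`). If some n β ≠ 0, then b, modulo
the form σu - u, has a simple pole at exactly one point of an orbit, and so has Σ lᵢ ∂ⁱb a pole at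
that point only. But σv - v has either no pole or at least two on an orbit (`no_telescoper`). Hence
a = μ zʳ σ(g)/g whatever N is, which gives parts 2 and 3. For N = 1 the integer r is itself of the
form σv - v, which forces r = 0 (`int_eq_zero_of_eq_sigma_sub`). Poles here are those of rational
functions in z over C_E, meaningful because z is transcendental over C_E.

Conversely, w = ∂f/f - ∂g/g satisfies σw = w + r, so w (if r = 0) or ∂w (in general) lies in C_E,
giving an explicit relation. -/

open Filter Topology

noncomputable section

namespace QDiff

/-! ### Invariant polynomials under affine shifts, and Ostrowski-type theorems. -/

section Shift

open MvPolynomial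
open scoped MonomialOrder

variable {ι L M : Type*} [Field L] [Field M] [Algebra L M]

/-- The endomorphism of a polynomial ring acting by `s` on coefficients and sending each variable
`X i` to `X i + b i`. -/
def shift (s : L →+* L) (b : ι → L) : MvPolynomial ι L →+* MvPolynomial ι L :=
  eval₂Hom (C.comp s) (fun i => X i + C (b i))

@[simp]
theorem shift_C (s : L →+* L) (b : ι → L) (c : L) : shift s b (C c) = C (s c) := by
  simp [shift]

@[simp]
theorem shift_X (s : L →+* L) (b : ι → L) (i : ι) : shift s b (X i) = X i + C (b i) := by
  simp [shift]

theorem shift_monomial (s : L →+* L) (b : ι → L) (e : ι →₀ ℕ) (c : L) :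
    shift s b (monomial e c) = C (s c) * e.prod fun i n => (X i + C (b i)) ^ n := by
  simp [shift]

theorem aeval_shift {s : L →+* L} {S : M →+* M} (hs : ∀ c, S (algebraMap L M c) =
    algebraMap L M (s c)) {b : ι → L} {y : ι → M} (hy : ∀ i, S (y i) = y i + algebraMap L M (b i))
    (P : MvPolynomial ι L) : aeval y (shift s b P) = S (aeval y P) := by
  have h : (aeval y : MvPolynomial ι L →ₐ[L] M).toRingHom.comp (shift s b) =
      S.comp (aeval y : MvPolynomial ι L →ₐ[L] M).toRingHom := by
    refine MvPolynomial.ringHom_ext ?_ ?_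
    · intro c; simp [hs]
    · intro i; simp [hy]
  exact congrArg (fun φ => φ P) h

/-- Translating variables by constants does not affect differentiation. Derivatives of an invariant
polynomial are thus invariant, which allows descent on the degree. -/
theorem pderiv_shift (s : L →+* L) (b : ι → L) (j : ι) (P : MvPolynomial ι L) :
    pderiv j (shift s b P) = shift s b (pderiv j P) := by
  classical
  induction P using MvPolynomial.induction_on with
  | C c => simp
  | add p q hp hq => simp [hp, hq]
  | mul_X p i hp =>
    rw [map_mul, pderiv_mul, pderiv_mul, hp, map_add, map_mul, map_mul]
    by_cases h : i = j
    · subst h; simp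
    · simp [pderiv_X_of_ne h]

theorem monic_prod_X_add_C (m : MonomialOrder ι) (b : ι → L) (e : ι →₀ ℕ) :
    m.Monic (e.prod fun i n => (X i + C (b i)) ^ n) :=
  MonomialOrder.Monic.prod fun i _ => (m.monic_X_add_C i (b i)).pow

theorem degree_prod_X_add_C (m : MonomialOrder ι) (b : ι → L) (e : ι →₀ ℕ) :
    m.degree (e.prod fun i n => (X i + C (b i)) ^ n) = e := by
  classical
  rw [Finsupp.prod, MonomialOrder.degree_prod
    fun i _ => (m.monic_X_add_C i (b i)).pow.ne_zero]
  conv_rhs => rw [← Finsupp.sum_single e]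
  refine Finset.sum_congr rfl fun i _ => ?_
  rw [MonomialOrder.degree_pow, MonomialOrder.degree_X_add_C, Finsupp.smul_single_one]

/-- A shifted monomial is monic of unchanged degree up to its coefficient, so monomials below `d`
contribute nothing at `d`. -/
theorem coeff_shift_of_degree_le (m : MonomialOrder ι) (s : L →+* L) (b : ι → L)
    {P : MvPolynomial ι L} {d : ι →₀ ℕ} (h : m.degree P ≼[m] d) :
    (shift s b P).coeff d = s (P.coeff d) := by
  classical
  conv_lhs => rw [P.as_sum, map_sum, coeff_sum]
  have key : ∀ e ∈ P.support, coeff d (shift s b (monomial e (P.coeff e))) =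
      if e = d then s (P.coeff d) else 0 := by
    intro e he
    rw [shift_monomial, coeff_C_mul]
    split_ifs with hed
    · subst hed
      have := monic_prod_X_add_C m b e
      rw [MonomialOrder.Monic, MonomialOrder.leadingCoeff, degree_prod_X_add_C] at this
      rw [this, mul_one]
    · have hlt : e ≺[m] d := lt_of_le_of_ne ((m.le_degree he).trans h)
        fun hh => hed (m.toSyn.injective hh)
      have h0 : (e.prod fun i n => (X i + C (b i)) ^ n).coeff d = 0 :=
        m.coeff_eq_zero_of_lt (by rwa [degree_prod_X_add_C])
      rw [h0, mul_zero]
  rw [Finset.sum_congr rfl key, Finset.sum_ite_eq']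
  split_ifs with hd
  · rfl
  · rw [notMem_support_iff.1 hd, map_zero]

theorem degree_shift_le (m : MonomialOrder ι) (s : L →+* L) (b : ι → L) (P : MvPolynomial ι L) :
    m.degree (shift s b P) ≼[m] m.degree P := by
  rw [MonomialOrder.degree_le_iff]
  intro c hc
  by_contra hlt
  rw [not_le] at hlt
  rw [mem_support_iff, coeff_shift_of_degree_le m s b hlt.le, m.coeff_eq_zero_of_lt hlt] at hc
  simp at hc

theorem degree_shift (m : MonomialOrder ι) (s : L →+* L) (b : ι → L) (P : MvPolynomial ι L) :
    m.degree (shift s b P) = m.degree P := by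
  by_cases hP : P = 0
  · simp [hP]
  refine m.toSyn.injective (le_antisymm (degree_shift_le m s b P) (m.le_degree ?_))
  rw [mem_support_iff, coeff_shift_of_degree_le m s b le_rfl, ne_eq,
    map_eq_zero, m.coeff_degree_eq_zero_iff]
  exact hP

theorem leadingCoeff_shift (m : MonomialOrder ι) (s : L →+* L) (b : ι → L)
    (P : MvPolynomial ι L) : m.leadingCoeff (shift s b P) = s (m.leadingCoeff P) := by
  rw [MonomialOrder.leadingCoeff, degree_shift, coeff_shift_of_degree_le m s b le_rfl]
  rfl

/-- A nonzero shift-stable ideal contains a nonzero shift-invariant polynomial. -/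
theorem exists_shift_eq_self (m : MonomialOrder ι) (s : L →+* L) (b : ι → L)
    (I : Ideal (MvPolynomial ι L)) (hI : ∀ P ∈ I, shift s b P ∈ I) (hne : ∃ P ∈ I, P ≠ 0) :
    ∃ P ∈ I, P ≠ 0 ∧ shift s b P = P := by
  classical
  obtain ⟨d, ⟨P, hPI, hP0, rfl⟩, hmin⟩ := WellFounded.has_min (wellFounded_lt (α := m.syn))
    {d | ∃ P ∈ I, P ≠ 0 ∧ m.toSyn (m.degree P) = d} (by
      obtain ⟨P, hPI, hP0⟩ := hne
      exact ⟨_, P, hPI, hP0, rfl⟩)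
  have hl : m.leadingCoeff P ≠ 0 := m.leadingCoeff_ne_zero_iff.2 hP0
  -- Once an element of minimal degree is made monic, the shift fixes its leading term, so `shift s
  -- b Q - Q` has smaller degree and must vanish.
  set Q := C (m.leadingCoeff P)⁻¹ * P with hQ
  have hQI : Q ∈ I := I.mul_mem_left _ hPI
  have hcoef : ∀ e, Q.coeff e = (m.leadingCoeff P)⁻¹ * P.coeff e := fun e => by
    rw [hQ, coeff_C_mul]
  have hQ1 : Q.coeff (m.degree P) = 1 := by
    rw [hcoef]; exact inv_mul_cancel₀ hl
  have hQle : m.degree Q ≼[m] m.degree P := by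
    rw [MonomialOrder.degree_le_iff]
    intro c hc
    refine m.le_degree ?_
    rw [mem_support_iff, hcoef] at hc
    exact mem_support_iff.2 (right_ne_zero_of_mul hc)
  have hQ0 : Q ≠ 0 := by rintro h; simp [h] at hQ1
  refine ⟨Q, hQI, hQ0, ?_⟩
  by_contra hne
  have hR0 : shift s b Q - Q ≠ 0 := sub_ne_zero.2 hne
  refine hmin _ ⟨_, I.sub_mem (hI Q hQI) hQI, hR0, rfl⟩ ?_
  have hle : m.degree (shift s b Q - Q) ≼[m] m.degree P := by
    refine m.degree_sub_le.trans ?_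
    rw [degree_shift, sup_idem]
    exact hQle
  refine lt_of_le_of_ne hle fun h => ?_
  have h1 := (m.leadingCoeff_ne_zero_iff (f := shift s b Q - Q)).2 hR0
  rw [MonomialOrder.leadingCoeff, m.toSyn.injective h, coeff_sub,
    coeff_shift_of_degree_le m s b hQle, hQ1] at h1
  simp at h1

/-- In characteristic zero, a non-constant shift-invariant polynomial yields a nontrivial linear
relation between the translations. -/
theorem exists_linear_of_shift_eq_self [Fintype ι] [CharZero L] (s : L →+* L) (b : ι → L) :
    ∀ (n : ℕ) (P : MvPolynomial ι L), P.totalDegree ≤ n → (∀ c, P ≠ C c) → shift s b P = P →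
      ∃ l : ι → L, l ≠ 0 ∧ (∀ i, s (l i) = l i) ∧ ∃ v, ∑ i, l i * b i = s v - v := by
  classical
  intro n
  induction n with
  | zero =>
    intro P hP hC _
    exact absurd (totalDegree_eq_zero_iff_eq_C.1 (Nat.le_zero.1 hP)) (hC _)
  | succ n ih =>
    intro P hP hC hs
    by_cases hall : ∀ j, ∃ c, pderiv j P = C c
    -- All partial derivatives are constant, so P is affine, c + Σ lᵢ Xᵢ. Invariance of P then reads
    -- Σ lᵢ bᵢ = c - s c, whence v = -c.
    · choose l hl using hall
      have hinv : ∀ i, s (l i) = l i := fun i => by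
        have := pderiv_shift s b i P
        rw [hs, hl, shift_C] at this
        exact (C_injective _ _ this).symm
      have hP' : P = C (coeff 0 P) + ∑ i, C (l i) * X i := by
        ext e
        by_cases he : e = 0
        · subst he
          simp [coeff_sum, coeff_C_mul, coeff_X]
        obtain ⟨j, hj⟩ : ∃ j, e j ≠ 0 := by
          by_contra! h
          exact he (Finsupp.ext h)
        have h1 : Finsupp.single j 1 ≤ e := by
          rw [Finsupp.single_le_iff]; omega
        obtain ⟨e', rfl⟩ := exists_add_of_le h1
        have h2 := coeff_pderiv (i := j) P e'
        have h3 := coeff_pderiv (i := j) (C (coeff 0 P) + ∑ i, C (l i) * X i) e'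
        have h4 : pderiv j (C (coeff 0 P) + ∑ i, C (l i) * X i) = C (l j) := by
          rw [map_add, pderiv_C, zero_add, map_sum]
          rw [Finset.sum_eq_single j]
          · simp
          · intro i _ hij
            rw [pderiv_C_mul, pderiv_X_of_ne hij, mul_zero]
          · simp
        rw [hl, ← h4, h3] at h2
        -- Characteristic zero: a coefficient is recovered from that of the derivative.
        have h5 : (e' j + 1 : L) ≠ 0 := by exact_mod_cast Nat.succ_ne_zero (e' j)
        rw [add_comm]
        exact (mul_right_cancel₀ h5 h2).symm
      refine ⟨l, ?_, hinv, - coeff 0 P, ?_⟩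
      · rintro rfl
        exact hC (coeff 0 P) (by simpa using hP')
      · set c := coeff 0 P
        have h6 := hs
        rw [hP'] at h6
        simp only [map_add, map_sum, map_mul, shift_C, shift_X, hinv, mul_add,
          Finset.sum_add_distrib] at h6
        have h7 : (C (∑ i, l i * b i) : MvPolynomial ι L) = C (c - s c) := by
          rw [map_sum, map_sub]
          simp only [map_mul]
          linear_combination h6
        rw [C_injective _ _ h7, map_neg]
        ring
    · push Not at hall
      obtain ⟨j, hj⟩ := hall
      refine ih (pderiv j P) ?_ hj ?_
      · refine Finset.sup_le fun e he => ?_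
        rw [mem_support_iff, coeff_pderiv] at he
        have h1 := le_totalDegree (mem_support_iff.2 (left_ne_zero_of_mul he))
        have h2 : ((e + Finsupp.single j 1).sum fun _ k => k) = (e.sum fun _ k => k) + 1 := by
          rw [Finsupp.sum_add_index' (by simp) (by simp)]
          simp
        omega
      · rw [← pderiv_shift, hs]

/-- Additive Ostrowski theorem: algebraically dependent solutions of `S y = y + b` satisfy a linear
relation with invariant coefficients. -/
theorem exists_linear_of_not_algebraicIndependent [Fintype ι] [CharZero L] (m : MonomialOrder ι)
    {s : L →+* L} {S : M →+* M} (hs : ∀ c, S (algebraMap L M c) = algebraMap L M (s c))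
    {b : ι → L} {y : ι → M} (hy : ∀ i, S (y i) = y i + algebraMap L M (b i))
    (hdep : ¬ AlgebraicIndependent L y) :
    ∃ l : ι → L, l ≠ 0 ∧ (∀ i, s (l i) = l i) ∧ ∃ v, ∑ i, l i * b i = s v - v := by
  rw [algebraicIndependent_iff] at hdep
  push Not at hdep
  obtain ⟨P, hPI, hP0⟩ := hdep
  obtain ⟨Q, hQI, hQ0, hQ⟩ := exists_shift_eq_self m s b
    (RingHom.ker (aeval y : MvPolynomial ι L →ₐ[L] M)) (fun P hP => by
      rw [RingHom.mem_ker] at hP ⊢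
      rw [aeval_shift hs hy, hP, map_zero]) ⟨P, hPI, hP0⟩
  refine exists_linear_of_shift_eq_self s b _ Q le_rfl ?_ hQ
  rintro c rfl
  rw [RingHom.mem_ker, aeval_C, map_eq_zero] at hQI
  exact hQ0 (by rw [hQI, map_zero])

/-- If `f` satisfies `S f = a f` and is algebraic over `L[y]`, where the `y i` are algebraically
independent with `S y = y + b`, then some power `a ^ m`, `m ≠ 0`, is of the form `s c / c`. -/
theorem exists_of_not_transcendental (m : MonomialOrder ι)
    {s : L →+* L} {S : M →+* M} (hs : ∀ c, S (algebraMap L M c) = algebraMap L M (s c))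
    {b : ι → L} {y : ι → M} (hy : ∀ i, S (y i) = y i + algebraMap L M (b i))
    (hindep : AlgebraicIndependent L y) {a : L} {f : M} (hf0 : f ≠ 0)
    (hf : S f = algebraMap L M a * f)
    (hdep : ¬ Transcendental (Algebra.adjoin L (Set.range y)) f) :
    ∃ c : L, c ≠ 0 ∧ ∃ j k : ℕ, j ≠ k ∧ s c * a ^ j = c * a ^ k := by
  classical
  let φ : MvPolynomial ι L →+* M := (aeval y : MvPolynomial ι L →ₐ[L] M).toRingHom
  have hφinj : Function.Injective φ := hindep
  have hφ : ∀ P, φ (shift s b P) = S (φ P) := aeval_shift hs hy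
  obtain ⟨p₀, hp₀, hp₀f⟩ : ∃ p : Polynomial (MvPolynomial ι L), p ≠ 0 ∧ p.eval₂ φ f = 0 := by
    have hdep' : IsAlgebraic (Algebra.adjoin L (Set.range y)) f := not_not.1 hdep
    obtain ⟨p, hp, hpf⟩ := hdep'
    let e := hindep.aevalEquiv
    refine ⟨p.map (e.symm : _ →+* MvPolynomial ι L), ?_, ?_⟩
    · rwa [ne_eq, Polynomial.map_eq_zero_iff]
      exact e.symm.injective
    · rw [Polynomial.eval₂_map]
      rw [Polynomial.aeval_def] at hpf
      have hcomp : φ.comp (e.symm : _ →+* MvPolynomial ι L) =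
          algebraMap (Algebra.adjoin L (Set.range y)) M := by
        ext x
        obtain ⟨t, rfl⟩ := e.surjective x
        have : (e.symm : _ →+* MvPolynomial ι L) (e t) = t := e.symm_apply_apply t
        rw [RingHom.comp_apply, this]
        exact (hindep.algebraMap_aevalEquiv t).symm
      rw [hcomp, hpf]
  -- An annihilator of f with fewest terms; it has at least two, as f ≠ 0.
  obtain ⟨n, ⟨p, hp0, hpf, rfl⟩, hmin⟩ := WellFounded.has_min (wellFounded_lt (α := ℕ))
    {n | ∃ p : Polynomial (MvPolynomial ι L), p ≠ 0 ∧ p.eval₂ φ f = 0 ∧ p.support.card = n}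
    ⟨_, p₀, hp₀, hp₀f, rfl⟩
  set k := p.natDegree with hk
  have hpk : p.coeff k ≠ 0 := by
    rw [hk, ← Polynomial.leadingCoeff]; exact Polynomial.leadingCoeff_ne_zero.2 hp0
  obtain ⟨j, hjk, hpj⟩ : ∃ j, j ≠ k ∧ p.coeff j ≠ 0 := by
    by_contra! h
    have : p = Polynomial.monomial k (p.coeff k) := by
      ext1 i
      rw [Polynomial.coeff_monomial]
      split_ifs with hik
      · rw [hik]
      · exact h i (Ne.symm hik)
    rw [this, Polynomial.eval₂_monomial] at hpf
    rcases mul_eq_zero.1 hpf with h1 | h1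
    · exact hpk ((injective_iff_map_eq_zero φ).1 hφinj _ h1)
    · exact pow_ne_zero k hf0 h1
  -- Applying S to the relation p(f) = 0 yields another relation, with coefficients shifted and f
  -- replaced by a f.
  let g : Polynomial (MvPolynomial ι L) :=
    (p.map (shift s b)).comp (Polynomial.C (C a) * Polynomial.X)
  have hgc : ∀ i, g.coeff i = shift s b (p.coeff i) * C a ^ i := fun i => by
    simp only [g, Polynomial.comp_C_mul_X_coeff, Polynomial.coeff_map]
  have hgf : g.eval₂ φ f = 0 := by
    have h1 : S (p.eval₂ φ f) = 0 := by rw [hpf, map_zero]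
    rw [Polynomial.hom_eval₂, hf] at h1
    rw [Polynomial.eval₂_comp, Polynomial.eval₂_map]
    have h2 : φ.comp (shift s b) = S.comp φ := RingHom.ext hφ
    rw [h2]
    simpa [φ] using h1
  -- The combination cancels the term of degree k and creates no new ones, so minimality forces it
  -- to vanish.
  let r := Polynomial.C (p.coeff k) * g - Polynomial.C (shift s b (p.coeff k) * C a ^ k) * p
  have hrc : ∀ i, r.coeff i = p.coeff k * (shift s b (p.coeff i) * C a ^ i) -
      shift s b (p.coeff k) * C a ^ k * p.coeff i := fun i => by
    simp only [r, Polynomial.coeff_sub, Polynomial.coeff_C_mul, hgc]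
  have hrf : r.eval₂ φ f = 0 := by
    simp only [r, Polynomial.eval₂_sub, Polynomial.eval₂_mul, hgf, hpf, mul_zero, sub_zero]
  have hr0 : r = 0 := by
    by_contra hr0
    refine hmin _ ⟨r, hr0, hrf, rfl⟩ (Finset.card_lt_card ?_)
    rw [Finset.ssubset_iff_of_subset]
    · refine ⟨k, Polynomial.mem_support_iff.2 hpk, ?_⟩
      rw [Polynomial.mem_support_iff, hrc, not_not]
      ring
    · intro i hi
      rw [Polynomial.mem_support_iff, hrc] at hi
      rw [Polynomial.mem_support_iff]
      intro h
      simp [h] at hi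
  have hj := hrc j
  rw [hr0, Polynomial.coeff_zero] at hj
  -- Leading coefficients are multiplicative and compatible with the shift, so the identity of
  -- polynomials descends to L.
  have hlc := congrArg m.leadingCoeff (sub_eq_zero.1 hj.symm)
  simp only [MonomialOrder.leadingCoeff_mul, leadingCoeff_shift, MonomialOrder.leadingCoeff_pow,
    MonomialOrder.leadingCoeff_C] at hlc
  set cj := m.leadingCoeff (p.coeff j)
  set ck := m.leadingCoeff (p.coeff k)
  have hcj : cj ≠ 0 := m.leadingCoeff_ne_zero_iff.2 hpj
  have hck : ck ≠ 0 := m.leadingCoeff_ne_zero_iff.2 hpk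
  have hsck : s ck ≠ 0 := (map_ne_zero s).2 hck
  refine ⟨cj / ck, div_ne_zero hcj hck, j, k, hjk, ?_⟩
  rw [map_div₀]
  field_simp
  linear_combination hlc

end Shift

/-! ### Algebraic independence under triangular changes of generators. -/

section Triangular

variable {L M : Type*} [Field L] [Field M] [Algebra L M]

/-- Algebraic independence is preserved under triangular affine changes of generators. -/
theorem algebraicIndepOn_of_triangular {x w : ℕ → M}
    (hw : ∀ n, ∃ u ∈ Algebra.adjoin L (x '' Set.Iio n), u ≠ 0 ∧
      ∃ v ∈ Algebra.adjoin L (x '' Set.Iio n), w n = u * x n + v)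
    (N : ℕ) (hx : AlgebraicIndepOn L x (Set.Iio N)) : AlgebraicIndepOn L w (Set.Iio N) := by
  induction N with
  | zero =>
    have h0 : Set.Iio 0 = (∅ : Set ℕ) := by ext; simp
    rw [h0]
    exact algebraicIndependent_empty_type_iff.2 (algebraMap L M).injective
  | succ n ih =>
    have hins : Set.Iio (n + 1) = insert n (Set.Iio n) := by
      ext i; simp only [Set.mem_Iio, Set.mem_insert_iff]; omega
    rw [hins] at hx ⊢
    obtain ⟨hxn, htr⟩ := (AlgebraicIndepOn.insert_iff (by simp)).1 hx
    refine (ih hxn).insert ?_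
    have hle : Algebra.adjoin L (w '' Set.Iio n) ≤ Algebra.adjoin L (x '' Set.Iio n) := by
      refine Algebra.adjoin_le ?_
      rintro _ ⟨i, hi, rfl⟩
      obtain ⟨u, hu, -, v, hv, h⟩ := hw i
      have hmono : Algebra.adjoin L (x '' Set.Iio i) ≤ Algebra.adjoin L (x '' Set.Iio n) :=
        Algebra.adjoin_mono (Set.image_mono (Set.Iio_subset_Iio (le_of_lt hi)))
      rw [h]
      exact add_mem (mul_mem (hmono hu) (Algebra.subset_adjoin ⟨i, hi, rfl⟩)) (hmono hv)
    refine Transcendental.of_tower_top_of_subalgebra_le hle fun halg => htr ?_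
    obtain ⟨u, hu, hu0, v, hv, h⟩ := hw n
    set B := Algebra.adjoin L (x '' Set.Iio n)
    have hu' : IsAlgebraic B u := isAlgebraic_algebraMap (⟨u, hu⟩ : B)
    have hv' : IsAlgebraic B v := isAlgebraic_algebraMap (⟨v, hv⟩ : B)
    have h2 : x n = (w n - v) * u⁻¹ := by
      rw [h]; field_simp; ring
    rw [h2]
    exact (halg.sub hv').mul hu'.inv

theorem algebraicIndependent_nat_of_Iio {x : ℕ → M}
    (hx : ∀ N, AlgebraicIndepOn L x (Set.Iio N)) : AlgebraicIndependent L x := by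
  refine algebraicIndependent_of_finite_type fun t ht => ?_
  obtain ⟨N, hN⟩ := ht.bddAbove
  exact (hx (N + 1)).comp (Set.inclusion fun i hi => Nat.lt_succ_of_le (hN hi))
    (Set.inclusion_injective _)

end Triangular

/-! ### Commutation of σ and ∂, and logarithmic derivatives. -/

section Basic

theorem sigma_z (q : ℂˣ) : sigma q z = algebraMap ℂ Mer q * z := by
  rw [← mk.commutes, z, sigma_mk, ← map_mul]
  rfl

theorem del_z : del z = z := by
  rw [z, del_mk, mk_eq_mk]
  intro x _
  refine Eventually.of_forall fun y => ?_
  simp [eulerFun]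

theorem del_sigma (q : ℂˣ) (φ : Mer) : del (sigma q φ) = sigma q (del φ) := by
  obtain ⟨f, rfl⟩ := mk_surjective φ
  rw [sigma_mk, del_mk, del_mk, sigma_mk, mk_eq_mk]
  intro x _
  refine Eventually.of_forall fun y => ?_
  change y * deriv (fun t => (f : ℂ → ℂ) ((q : ℂ) * t)) y =
    ((q : ℂ) * y) * deriv (f : ℂ → ℂ) ((q : ℂ) * y)
  rw [deriv_comp_mul_left, smul_eq_mul]
  ring

theorem z_ne_zero : z ≠ 0 := by
  intro h
  rw [z, mk_eq_zero] at h
  obtain ⟨y, hy, hy0⟩ := ((h 1 one_ne_zero).and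
    ((continuous_id.tendsto (1 : ℂ)).mono_left nhdsWithin_le_nhds |>.eventually_ne
      (one_ne_zero))).exists
  exact hy0 hy

theorem del_iterate_sigma (q : ℂˣ) (n : ℕ) (φ : Mer) :
    del^[n] (sigma q φ) = sigma q (del^[n] φ) := by
  induction n generalizing φ with
  | zero => rfl
  | succ n ih => rw [Function.iterate_succ_apply, Function.iterate_succ_apply, del_sigma, ih]

theorem del_iterate_add (n : ℕ) (φ ψ : Mer) :
    del^[n] (φ + ψ) = del^[n] φ + del^[n] ψ := by
  induction n generalizing φ ψ with
  | zero => rfl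
  | succ n ih => simp only [Function.iterate_succ_apply, map_add, ih]

/-- The logarithmic derivative with respect to `del`. -/
def dlog (φ : Mer) : Mer := del φ / φ

theorem dlog_mul {φ ψ : Mer} (hφ : φ ≠ 0) (hψ : ψ ≠ 0) : dlog (φ * ψ) = dlog φ + dlog ψ := by
  rw [dlog, dlog, dlog, Derivation.leibniz, smul_eq_mul, smul_eq_mul]
  field_simp
  ring

@[simp]
theorem dlog_one : dlog 1 = 0 := by simp [dlog]

theorem dlog_inv (φ : Mer) : dlog φ⁻¹ = - dlog φ := by
  by_cases h : φ = 0
  · simp [h, dlog]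
  have := dlog_mul h (inv_ne_zero h)
  rw [mul_inv_cancel₀ h, dlog_one] at this
  linear_combination -this

theorem dlog_div {φ ψ : Mer} (hφ : φ ≠ 0) (hψ : ψ ≠ 0) : dlog (φ / ψ) = dlog φ - dlog ψ := by
  rw [div_eq_mul_inv, dlog_mul hφ (inv_ne_zero hψ), dlog_inv, sub_eq_add_neg]

theorem dlog_pow {φ : Mer} (hφ : φ ≠ 0) (n : ℕ) : dlog (φ ^ n) = n * dlog φ := by
  induction n with
  | zero => simp
  | succ n ih => rw [pow_succ, dlog_mul (pow_ne_zero n hφ) hφ, ih]; push_cast; ring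

theorem dlog_zpow {φ : Mer} (hφ : φ ≠ 0) (n : ℤ) : dlog (φ ^ n) = n * dlog φ := by
  obtain ⟨n, rfl | rfl⟩ := n.eq_nat_or_neg
  · simpa using dlog_pow hφ n
  · rw [zpow_neg, dlog_inv, zpow_natCast, dlog_pow hφ]; push_cast; ring

theorem dlog_algebraMap (c : ℂ) : dlog (algebraMap ℂ Mer c) = 0 := by
  simp [dlog]

theorem dlog_z : dlog z = 1 := by
  rw [dlog, del_z, div_self z_ne_zero]

theorem dlog_sigma (q : ℂˣ) (φ : Mer) : dlog (sigma q φ) = sigma q (dlog φ) := by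
  rw [dlog, del_sigma, dlog, map_div₀]

end Basic

/-! ### C_E(z) as a difference-differential field. -/

section Field

open Polynomial

variable {q : ℂˣ}

theorem mem_CE {φ : Mer} : φ ∈ CE q ↔ sigma q φ = φ := Iff.rfl

theorem del_mem_CE {φ : Mer} (h : φ ∈ CE q) : del φ ∈ CE q := by
  rw [mem_CE] at h ⊢
  rw [← del_sigma, h]

theorem CE_le_KE : CE q ≤ KE q := le_sup_left

theorem K_le_KE : K ≤ KE q := le_sup_right

theorem z_mem_K : z ∈ K := IntermediateField.mem_adjoin_simple_self ℂ z

theorem z_mem_KE : z ∈ KE q := K_le_KE z_mem_K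

theorem aeval_z_mem_KE (P : (CE q)[X]) : aeval z P ∈ KE q := by
  induction P using Polynomial.induction_on' with
  | add p r hp hr => rw [map_add]; exact add_mem hp hr
  | monomial n c =>
    rw [aeval_monomial]
    exact mul_mem (CE_le_KE c.2) (pow_mem z_mem_KE n)

/-- The compositum is the simple extension of C_E generated by z. -/
theorem mem_KE_iff {φ : Mer} : φ ∈ KE q ↔ ∃ P Q : (CE q)[X], φ = aeval z P / aeval z Q := by
  rw [← IntermediateField.mem_adjoin_simple_iff]
  constructor
  · have : KE q ≤ (IntermediateField.adjoin (CE q) {z}).restrictScalars ℂ := by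
      refine sup_le (fun x hx => ?_) ?_
      · exact IntermediateField.algebraMap_mem (IntermediateField.adjoin (CE q) {z}) (⟨x, hx⟩ : CE q)
      · refine IntermediateField.adjoin_le_iff.2 ?_
        rintro _ rfl
        exact IntermediateField.mem_adjoin_simple_self (CE q) z
    exact fun h => this h
  · rw [IntermediateField.mem_adjoin_simple_iff]
    rintro ⟨P, Q, rfl⟩
    exact div_mem (aeval_z_mem_KE P) (aeval_z_mem_KE Q)

/-- The substitution `X ↦ q X`. -/
def scale (q : ℂˣ) (P : (CE q)[X]) : (CE q)[X] := P.comp (C (algebraMap ℂ (CE q) q) * X)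

theorem sigma_aeval (P : (CE q)[X]) : sigma q (aeval z P) = aeval z (scale q P) := by
  rw [scale, aeval_comp]
  induction P using Polynomial.induction_on' with
  | add p r hp hr => rw [map_add, map_add, map_add, hp, hr]
  | monomial n c =>
    have hc : sigma q (c : Mer) = c := c.2
    simp only [aeval_monomial, map_mul, map_pow, aeval_X, aeval_C, sigma_z]
    congr 1

theorem exists_del_aeval (P : (CE q)[X]) : ∃ Q : (CE q)[X], del (aeval z P) = aeval z Q := by
  induction P using Polynomial.induction_on' with
  | add p r hp hr =>
    obtain ⟨Q, hQ⟩ := hp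
    obtain ⟨R, hR⟩ := hr
    exact ⟨Q + R, by rw [map_add, map_add, map_add, hQ, hR]⟩
  | monomial n c =>
    refine ⟨monomial n (⟨del c, del_mem_CE c.2⟩ + n * c), ?_⟩
    rw [aeval_monomial, aeval_monomial, Derivation.leibniz, Derivation.leibniz_pow, del_z]
    change (c : Mer) * _ + _ * del (c : Mer) = (del (c : Mer) + n * (c : Mer)) * _
    cases n with
    | zero => simp
    | succ n =>
      simp only [smul_eq_mul, nsmul_eq_mul, Nat.add_sub_cancel]
      ring

theorem sigma_mem_KE {φ : Mer} (h : φ ∈ KE q) : sigma q φ ∈ KE q := by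
  obtain ⟨P, Q, rfl⟩ := mem_KE_iff.1 h
  rw [map_div₀, sigma_aeval, sigma_aeval]
  exact div_mem (aeval_z_mem_KE _) (aeval_z_mem_KE _)

theorem del_mem_KE {φ : Mer} (h : φ ∈ KE q) : del φ ∈ KE q := by
  obtain ⟨P, Q, rfl⟩ := mem_KE_iff.1 h
  obtain ⟨P', hP'⟩ := exists_del_aeval P
  obtain ⟨Q', hQ'⟩ := exists_del_aeval Q
  rw [Derivation.leibniz_div, hP', hQ']
  simp only [smul_eq_mul]
  have := @aeval_z_mem_KE q
  exact mul_mem (pow_mem (inv_mem (this _)) 2)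
    (sub_mem (mul_mem (this _) (this _)) (mul_mem (this _) (this _)))

theorem del_iterate_mem_KE {φ : Mer} (h : φ ∈ KE q) (n : ℕ) : del^[n] φ ∈ KE q := by
  induction n with
  | zero => exact h
  | succ n ih => rw [Function.iterate_succ_apply']; exact del_mem_KE ih

theorem dlog_mem_KE {φ : Mer} (h : φ ∈ KE q) : dlog φ ∈ KE q := div_mem (del_mem_KE h) h

/-- The restriction of `sigma q` to `KE q`. -/
def sigmaKE (q : ℂˣ) : KE q →+* KE q :=
  (sigma q : Mer →+* Mer).restrict (KE q) (KE q) fun _ h => sigma_mem_KE h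

/-- σ is C_E-linear and the powers zⁿ are eigenvectors with eigenvalues qⁿ, distinct since |q| ≠ 1;
hence they are linearly independent. -/
theorem transcendental_z (hq : ‖(q : ℂ)‖ ≠ 1) : Transcendental (CE q) z := by
  have hinj : Function.Injective fun n : ℕ => algebraMap ℂ (CE q) q ^ n := by
    intro m n h
    simp only [← map_pow] at h
    have h1 := congrArg norm ((algebraMap ℂ (CE q)).injective h)
    rw [norm_pow, norm_pow] at h1
    exact pow_right_injective₀ (norm_pos_iff.2 q.ne_zero) hq h1
  let S : Module.End (CE q) Mer :=
    { toFun := sigma q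
      map_add' := map_add _
      map_smul' := fun c φ => by
        have hc : sigma q (c : Mer) = c := c.2
        rw [RingHom.id_apply, IntermediateField.smul_def, IntermediateField.smul_def, smul_eq_mul,
          smul_eq_mul, map_mul, hc] }
  have hli := Module.End.eigenvectors_linearIndependent' S _ hinj (fun n : ℕ => z ^ n) fun n => by
    refine ⟨Module.End.mem_eigenspace_iff.2 ?_, pow_ne_zero n z_ne_zero⟩
    change sigma q (z ^ n) = (((algebraMap ℂ (CE q) q ^ n : CE q)) : Mer) * z ^ n
    rw [map_pow, sigma_z, mul_pow]
    rfl
  rw [transcendental_iff]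
  intro P hP
  rw [aeval_eq_sum_range] at hP
  refine Polynomial.ext fun i => ?_
  rw [coeff_zero]
  by_cases hi : i ∈ Finset.range (P.natDegree + 1)
  · exact linearIndependent_iff'.1 hli _ (fun i => P.coeff i) hP i hi
  · exact coeff_eq_zero_of_natDegree_lt (by simpa using hi)

theorem aeval_z_injective (hq : ‖(q : ℂ)‖ ≠ 1) :
    Function.Injective (aeval z : (CE q)[X] →ₐ[CE q] Mer) :=
  transcendental_iff_injective.1 (transcendental_z hq)

end Field

instance : CharZero Mer := charZero_of_injective_algebraMap (algebraMap ℂ Mer).injective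

/-! ### Poles along q-orbits of rational functions over C_E. -/

section Poles

open Polynomial

variable {q : ℂˣ}

theorem eval_scale (P : (CE q)[X]) (c : ℂ) :
    (scale q P).eval (algebraMap ℂ (CE q) c) = P.eval (algebraMap ℂ (CE q) (q * c)) := by
  rw [scale, eval_comp]
  simp

theorem scale_surjective (q : ℂˣ) : Function.Surjective (scale q) := by
  intro P
  refine ⟨P.comp (C (algebraMap ℂ (CE q) (q : ℂ)⁻¹) * X), ?_⟩
  rw [scale, comp_assoc]
  simp only [mul_comp, C_comp, X_comp]
  rw [← mul_assoc, ← C_mul, ← map_mul, inv_mul_cancel₀ q.ne_zero, map_one, C_1, one_mul, comp_X]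

/-- The elements of `ℳer(ℂ*)` of the form `P(z) / Q(z)` with `P`, `Q` polynomials over `C_E` and
`Q(c) ≠ 0`. -/
def reg (q : ℂˣ) (c : ℂ) : Subring Mer where
  carrier := {φ | ∃ P Q : (CE q)[X], Q.eval (algebraMap ℂ (CE q) c) ≠ 0 ∧
    φ * aeval z Q = aeval z P}
  mul_mem' := by
    rintro φ ψ ⟨P, Q, hQ, h⟩ ⟨P', Q', hQ', h'⟩
    refine ⟨P * P', Q * Q', by rw [eval_mul]; exact mul_ne_zero hQ hQ', ?_⟩
    rw [map_mul, map_mul, ← h, ← h']; ring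
  one_mem' := ⟨1, 1, by simp, by simp⟩
  add_mem' := by
    rintro φ ψ ⟨P, Q, hQ, h⟩ ⟨P', Q', hQ', h'⟩
    refine ⟨P * Q' + P' * Q, Q * Q', by rw [eval_mul]; exact mul_ne_zero hQ hQ', ?_⟩
    rw [map_add, map_mul, map_mul, map_mul, ← h, ← h']; ring
  zero_mem' := ⟨0, 1, by simp, by simp⟩
  neg_mem' := by
    rintro φ ⟨P, Q, hQ, h⟩
    exact ⟨-P, Q, hQ, by rw [map_neg, ← h]; ring⟩

theorem aeval_mem_reg (P : (CE q)[X]) (c : ℂ) : aeval z P ∈ reg q c :=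
  ⟨P, 1, by simp, by simp⟩

theorem mem_reg_of_mem_CE {φ : Mer} (h : φ ∈ CE q) (c : ℂ) : φ ∈ reg q c :=
  ⟨C ⟨φ, h⟩, 1, by simp, by simp⟩

theorem del_mem_reg {c : ℂ} {φ : Mer} (h : φ ∈ reg q c) : del φ ∈ reg q c := by
  obtain ⟨P, Q, hQ, h⟩ := h
  obtain ⟨P', hP'⟩ := exists_del_aeval P
  obtain ⟨Q', hQ'⟩ := exists_del_aeval Q
  refine ⟨P' * Q - P * Q', Q * Q, by rw [eval_mul]; exact mul_ne_zero hQ hQ, ?_⟩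
  have h1 := congrArg del h
  rw [Derivation.leibniz, hP', hQ', smul_eq_mul, smul_eq_mul] at h1
  rw [map_sub, map_mul, map_mul, map_mul, ← h1, ← h]
  ring

/-- σ translates the poles along q-orbits. -/
theorem sigma_mem_reg_iff {c : ℂ} {φ : Mer} : sigma q φ ∈ reg q c ↔ φ ∈ reg q (q * c) := by
  constructor
  · rintro ⟨P, Q, hQ, h⟩
    obtain ⟨P, rfl⟩ := scale_surjective q P
    obtain ⟨Q, rfl⟩ := scale_surjective q Q
    refine ⟨P, Q, by rwa [eval_scale] at hQ, ?_⟩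
    rw [← sigma_aeval, ← sigma_aeval, ← map_mul] at h
    exact (sigma q).injective h
  · rintro ⟨P, Q, hQ, h⟩
    refine ⟨scale q P, scale q Q, by rwa [eval_scale], ?_⟩
    rw [← sigma_aeval, ← sigma_aeval, ← map_mul, h]

theorem finite_not_mem_reg {φ : Mer} (h : φ ∈ KE q) : {c : ℂ | φ ∉ reg q c}.Finite := by
  obtain ⟨P, Q, rfl⟩ := mem_KE_iff.1 h
  by_cases hQ : (aeval z Q : Mer) = 0
  -- With a zero denominator the quotient is 0 by convention, hence regular everywhere.
  · convert Set.finite_empty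
    ext c
    simp [hQ, zero_mem]
  · have hQ0 : Q ≠ 0 := by rintro rfl; simp at hQ
    refine (Set.Finite.preimage (f := algebraMap ℂ (CE q))
      (algebraMap ℂ (CE q)).injective.injOn (finite_setOfPred_isRoot hQ0)).subset ?_
    intro c hc
    by_contra hroot
    exact hc ⟨P, Q, hroot, div_mul_cancel₀ _ hQ⟩

/-- The elements of `ℳer(ℂ*)` of the form `P(z) / Q(z)` with `P`, `Q` polynomials over `C_E` and
`P(c) ≠ 0`, `Q(c) ≠ 0`. -/
def IsRegUnit (q : ℂˣ) (c : ℂ) (φ : Mer) : Prop :=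
  ∃ P Q : (CE q)[X], P.eval (algebraMap ℂ (CE q) c) ≠ 0 ∧ Q.eval (algebraMap ℂ (CE q) c) ≠ 0 ∧
    φ * aeval z Q = aeval z P

theorem IsRegUnit.mem_reg {c : ℂ} {φ : Mer} (h : IsRegUnit q c φ) : φ ∈ reg q c := by
  obtain ⟨P, Q, -, hQ, h⟩ := h
  exact ⟨P, Q, hQ, h⟩

theorem IsRegUnit.mul {c : ℂ} {φ ψ : Mer} (h : IsRegUnit q c φ) (h' : IsRegUnit q c ψ) :
    IsRegUnit q c (φ * ψ) := by
  obtain ⟨P, Q, hP, hQ, h⟩ := h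
  obtain ⟨P', Q', hP', hQ', h'⟩ := h'
  refine ⟨P * P', Q * Q', by rw [eval_mul]; exact mul_ne_zero hP hP',
    by rw [eval_mul]; exact mul_ne_zero hQ hQ', ?_⟩
  rw [map_mul, map_mul, ← h, ← h']; ring

theorem isRegUnit_of_mem_CE {φ : Mer} (h : φ ∈ CE q) (h0 : φ ≠ 0) (c : ℂ) :
    IsRegUnit q c φ :=
  ⟨C ⟨φ, h⟩, 1, by simpa [Subtype.ext_iff] using h0, by simp, by simp⟩

theorem isRegUnit_z {c : ℂ} (hc : c ≠ 0) : IsRegUnit q c z :=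
  ⟨X, 1, by simpa using hc, by simp, by simp⟩

theorem aeval_X_sub_C (c : ℂ) :
    aeval z (X - C (algebraMap ℂ (CE q) c) : (CE q)[X]) = z - algebraMap ℂ Mer c := by
  rw [map_sub, aeval_X, aeval_C]
  rfl

theorem IsRegUnit.add_mul {c : ℂ} {φ ψ : Mer} (h : IsRegUnit q c φ) (h' : ψ ∈ reg q c) :
    IsRegUnit q c (φ + (z - algebraMap ℂ Mer c) * ψ) := by
  obtain ⟨P, Q, hP, hQ, h⟩ := h
  obtain ⟨P', Q', hQ', h'⟩ := h'
  refine ⟨P * Q' + (X - C (algebraMap ℂ (CE q) c)) * P' * Q, Q * Q', ?_,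
    by rw [eval_mul]; exact mul_ne_zero hQ hQ', ?_⟩
  · simp only [eval_add, eval_mul, eval_sub, eval_X, eval_C, sub_self, zero_mul, add_zero]
    exact mul_ne_zero hP hQ'
  · rw [map_add, map_mul, map_mul, map_mul, map_mul, aeval_X_sub_C, ← h, ← h']
    ring

/-- Transcendence of z turns the equality into one of polynomials, which can be evaluated at c. -/
theorem sub_mul_not_isRegUnit (hq : ‖(q : ℂ)‖ ≠ 1) {c : ℂ} {ψ : Mer} (h' : ψ ∈ reg q c) :
    ¬ IsRegUnit q c ((z - algebraMap ℂ Mer c) * ψ) := by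
  rintro ⟨P, Q, hP, hQ, h⟩
  obtain ⟨P', Q', hQ', h'⟩ := h'
  have h1 : (aeval z ((X - C (algebraMap ℂ (CE q) c)) * P' * Q) : Mer) = aeval z (P * Q') := by
    rw [map_mul, map_mul, map_mul, aeval_X_sub_C, ← h, ← h']
    ring
  have h2 := congrArg (eval (algebraMap ℂ (CE q) c)) (aeval_z_injective hq h1)
  simp only [eval_mul, eval_sub, eval_X, eval_C, sub_self, zero_mul] at h2
  exact mul_ne_zero hP hQ' h2.symm

theorem isRegUnit_z_sub {c d : ℂ} (h : c ≠ d) : IsRegUnit q c (z - algebraMap ℂ Mer d) := by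
  refine ⟨X - C (algebraMap ℂ (CE q) d), 1, ?_, by simp, ?_⟩
  · simpa [sub_eq_zero] using h
  · rw [aeval_X_sub_C]; simp

theorem IsRegUnit.inv {c : ℂ} {φ : Mer} (h0 : φ ≠ 0) (h : IsRegUnit q c φ) :
    IsRegUnit q c φ⁻¹ := by
  obtain ⟨P, Q, hP, hQ, h⟩ := h
  refine ⟨Q, P, hQ, hP, ?_⟩
  rw [← h, inv_mul_cancel_left₀ h0]

theorem z_sub_ne_zero (c : ℂ) : z - algebraMap ℂ Mer c ≠ 0 := by
  intro h
  have h1 := congrArg del h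
  rw [map_sub, del_z, Derivation.map_algebraMap, sub_zero, map_zero] at h1
  exact z_ne_zero h1

/-- With t = z - c, one has tˢ⁺² ∂φ = -(s+1) z (tˢ⁺¹φ) + t ∂(tˢ⁺¹φ). The first term is a unit at c
because c ≠ 0, so ∂ raises the pole order by exactly one. -/
theorem IsRegUnit.pole_del {c : ℂ} (hc : c ≠ 0) {φ : Mer} {s : ℕ}
    (h : IsRegUnit q c ((z - algebraMap ℂ Mer c) ^ (s + 1) * φ)) :
    IsRegUnit q c ((z - algebraMap ℂ Mer c) ^ (s + 2) * del φ) := by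
  set t := z - algebraMap ℂ Mer c with ht
  have hdt : del t = z := by
    rw [ht, map_sub, del_z, Derivation.map_algebraMap, sub_zero]
  have hs : algebraMap ℂ Mer (-(s + 1)) ∈ CE q := (CE q).algebraMap_mem _
  have hs0 : algebraMap ℂ Mer (-(s + 1)) ≠ 0 := by
    rw [ne_eq, map_eq_zero, neg_eq_zero]
    exact_mod_cast Nat.succ_ne_zero s
  have h1 := (((isRegUnit_of_mem_CE hs hs0 c).mul (isRegUnit_z hc)).mul h).add_mul
    (del_mem_reg h.mem_reg)
  convert h1 using 1
  rw [Derivation.leibniz, Derivation.leibniz_pow, hdt]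
  simp only [smul_eq_mul, nsmul_eq_mul, Nat.add_sub_cancel, map_neg, map_add, map_natCast, map_one,
    Nat.cast_add, Nat.cast_one]
  ring

theorem IsRegUnit.pole_del_iterate {c : ℂ} (hc : c ≠ 0) {φ : Mer}
    (h : IsRegUnit q c ((z - algebraMap ℂ Mer c) * φ)) (i : ℕ) :
    IsRegUnit q c ((z - algebraMap ℂ Mer c) ^ (i + 1) * del^[i] φ) := by
  induction i with
  | zero => simpa using h
  | succ i ih => rw [Function.iterate_succ_apply']; exact ih.pole_del hc

theorem pow_mul_sum_mem_reg {c : ℂ} (hc : c ≠ 0) {φ : Mer}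
    (h : IsRegUnit q c ((z - algebraMap ℂ Mer c) * φ)) {l : ℕ → Mer} (hl : ∀ i, l i ∈ CE q)
    (N : ℕ) : (z - algebraMap ℂ Mer c) ^ N * ∑ i ∈ Finset.range N, l i * del^[i] φ ∈ reg q c := by
  rw [Finset.mul_sum]
  refine sum_mem fun i hi => ?_
  obtain ⟨k, rfl⟩ := Nat.exists_eq_add_of_lt (Finset.mem_range.1 hi)
  have h1 : z - algebraMap ℂ Mer c ∈ reg q c := by
    rw [← aeval_X_sub_C (q := q)]; exact aeval_mem_reg _ c
  have h2 := mul_mem (mul_mem (mem_reg_of_mem_CE (hl i) c) (pow_mem h1 k))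
    (h.pole_del_iterate hc i).mem_reg
  convert h2 using 1
  ring

/-- ∂ⁱφ has a pole of order exactly i + 1, so the last nonzero term of the sum cannot be cancelled.
-/
theorem sum_not_mem_reg (hq : ‖(q : ℂ)‖ ≠ 1) {c : ℂ} (hc : c ≠ 0) {φ : Mer}
    (h : IsRegUnit q c ((z - algebraMap ℂ Mer c) * φ)) {l : ℕ → Mer} (hl : ∀ i, l i ∈ CE q)
    (N : ℕ) (hl0 : ∃ i < N, l i ≠ 0) : ∑ i ∈ Finset.range N, l i * del^[i] φ ∉ reg q c := by
  induction N with
  | zero => obtain ⟨i, hi, -⟩ := hl0; exact absurd hi (Nat.not_lt_zero i)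
  | succ N ih =>
    by_cases hN : l N = 0
    · rw [Finset.sum_range_succ, hN, zero_mul, add_zero]
      refine ih ?_
      obtain ⟨i, hi, hi0⟩ := hl0
      exact ⟨i, lt_of_le_of_ne (Nat.le_of_lt_succ hi) (by rintro rfl; exact hi0 hN), hi0⟩
    · intro hreg
      have h1 : z - algebraMap ℂ Mer c ∈ reg q c := by
        rw [← aeval_X_sub_C (q := q)]; exact aeval_mem_reg _ c
      refine sub_mul_not_isRegUnit hq (mul_mem (pow_mem h1 N) hreg) ?_
      have h2 := ((isRegUnit_of_mem_CE (hl N) hN c).mul (h.pole_del_iterate hc N)).add_mul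
        (pow_mul_sum_mem_reg hc h hl N)
      convert h2 using 1
      rw [Finset.sum_range_succ]
      ring

theorem zpow_injective (hq : ‖(q : ℂ)‖ ≠ 1) : Function.Injective fun k : ℤ => (q : ℂ) ^ k := by
  intro m n h
  have h1 := congrArg norm h
  simp only [norm_zpow] at h1
  exact zpow_right_injective₀ (norm_pos_iff.2 q.ne_zero) hq h1

/-- A function with a simple pole at exactly one point of a `q`-orbit has no telescoper. -/
theorem no_telescoper (hq : ‖(q : ℂ)‖ ≠ 1) {c : ℂ} (hc : c ≠ 0) {φ : Mer}
    (h : IsRegUnit q c ((z - algebraMap ℂ Mer c) * φ))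
    (hreg : ∀ k : ℤ, k ≠ 0 → φ ∈ reg q ((q : ℂ) ^ k * c))
    {l : ℕ → Mer} (hl : ∀ i, l i ∈ CE q) (N : ℕ) (hl0 : ∃ i < N, l i ≠ 0) {v : Mer}
    (hv : v ∈ KE q) : ∑ i ∈ Finset.range N, l i * del^[i] φ ≠ sigma q v - v := by
  intro heq
  set w := ∑ i ∈ Finset.range N, l i * del^[i] φ with hw
  have hw0 : w ∉ reg q c := sum_not_mem_reg hq hc h hl N hl0
  have hwk : ∀ k : ℤ, w ∉ reg q ((q : ℂ) ^ k * c) → k = 0 := by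
    intro k hk
    by_contra hk0
    refine hk (sum_mem fun i hi => mul_mem (mem_reg_of_mem_CE (hl i) _) ?_)
    clear hi
    induction i with
    | zero => exact hreg k hk0
    | succ i ih => rw [Function.iterate_succ_apply']; exact del_mem_reg ih
  let S : Set ℤ := {k | v ∉ reg q ((q : ℂ) ^ k * c)}
  have hSfin : S.Finite := Set.Finite.preimage (f := fun k : ℤ => (q : ℂ) ^ k * c)
    (fun m _ n _ hmn => zpow_injective hq (mul_right_cancel₀ hc hmn)) (finite_not_mem_reg hv)
  have hσ : ∀ k : ℤ, sigma q v ∉ reg q ((q : ℂ) ^ k * c) ↔ k + 1 ∈ S := by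
    intro k
    rw [sigma_mem_reg_iff, ← mul_assoc, ← zpow_one_add₀ q.ne_zero, add_comm]
    rfl
  have hSne : S.Nonempty := by
    by_contra hne
    rw [Set.not_nonempty_iff_eq_empty] at hne
    have h1 : v ∈ reg q c := by
      by_contra h1
      have : (0 : ℤ) ∈ S := by change v ∉ _; simpa using h1
      simp [hne] at this
    have h2 : sigma q v ∈ reg q c := by
      by_contra h2
      have := (hσ 0).1 (by simpa using h2)
      simp [hne] at this
    exact hw0 (heq ▸ sub_mem h2 h1)
  -- On the orbit, the last pole n of v is not a pole of σv, and the first pole m - 1 of σv is not a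
  -- pole of v. Both are poles of w, so n = 0 and m = 1, contradicting m ≤ n.
  obtain ⟨m, hmS, hm⟩ := Set.exists_min_image S id hSfin hSne
  obtain ⟨n, hnS, hn⟩ := Set.exists_max_image S id hSfin hSne
  simp only [id_eq] at hm hn
  have hn0 : n = 0 := by
    refine hwk n fun hmem => hnS ?_
    have h1 : sigma q v ∈ reg q ((q : ℂ) ^ n * c) := by
      by_contra h1
      have := hn _ ((hσ n).1 h1)
      omega
    have h2 : v = sigma q v - w := by rw [heq]; ring
    rw [h2]
    exact sub_mem h1 hmem
  have hm0 : m - 1 = 0 := by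
    refine hwk (m - 1) fun hmem => (hσ (m - 1)).2 (by simpa using hmS) ?_
    have h1 : v ∈ reg q ((q : ℂ) ^ (m - 1) * c) := by
      by_contra h1
      have := hm (m - 1) h1
      omega
    have h2 : sigma q v = v + w := by rw [heq]; ring
    rw [h2]
    exact add_mem h1 hmem
  have := hm n hnS
  omega

theorem exists_X_pow_mul {P : (CE q)[X]} (hP : P ≠ 0) :
    ∃ (n : ℕ) (R : (CE q)[X]), P = X ^ n * R ∧ R.eval 0 ≠ 0 := by
  obtain ⟨R, hR, hR0⟩ := exists_eq_pow_rootMultiplicity_mul_and_not_dvd P hP 0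
  rw [C_0, sub_zero] at hR hR0
  refine ⟨_, R, hR, ?_⟩
  rwa [X_dvd_iff, coeff_zero_eq_eval_zero] at hR0

/-- A nonzero integer is not of the form `σ v - v` with `v` in `C_E(z)`. -/
theorem int_eq_zero_of_eq_sigma_sub (hq : ‖(q : ℂ)‖ ≠ 1) {v : Mer} (hv : v ∈ KE q) {r : ℤ}
    (h : (r : Mer) = sigma q v - v) : r = 0 := by
  by_contra hr
  obtain ⟨P, Q, rfl⟩ := mem_KE_iff.1 hv
  by_cases hQ : (aeval z Q : Mer) = 0
  · exact hr (by simpa [hQ] using h)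
  by_cases hP : P = 0
  · exact hr (by simpa [hP] using h)
  have hQ0 : Q ≠ 0 := by rintro rfl; simp at hQ
  have hσQ : (aeval z (scale q Q) : Mer) ≠ 0 := by
    rw [← sigma_aeval]; exact (_root_.map_ne_zero _).2 hQ
  rw [map_div₀, sigma_aeval, sigma_aeval] at h
  have h1 : scale q P * Q - P * scale q Q = (r : (CE q)[X]) * (Q * scale q Q) := by
    refine aeval_z_injective hq ?_
    rw [map_sub, map_mul, map_mul, map_mul, map_mul, map_intCast, h]
    field_simp
  obtain ⟨p, P', hP', hP0⟩ := exists_X_pow_mul hP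
  obtain ⟨n, Q', hQ', hQ0'⟩ := exists_X_pow_mul hQ0
  set κ : CE q := algebraMap ℂ (CE q) q with hκ
  have hκ0 : κ ≠ 0 := (_root_.map_ne_zero _).2 q.ne_zero
  have hsc : ∀ (m : ℕ) (R : (CE q)[X]), scale q (X ^ m * R) = C κ ^ m * X ^ m * scale q R := by
    intro m R
    rw [scale, scale, mul_comp, X_pow_comp, mul_pow]
  have hsc0 : ∀ R : (CE q)[X], (scale q R).eval 0 = R.eval 0 := by
    intro R
    rw [scale, eval_comp]; simp
  have hr' : ((r : ℤ) : CE q) ≠ 0 := Int.cast_ne_zero.2 hr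
  rw [hP', hQ', hsc, hsc] at h1
  have h2 : X ^ n * (X ^ p * (C κ ^ p * scale q P' * Q' - C κ ^ n * P' * scale q Q')) =
      X ^ n * (X ^ n * ((r : (CE q)[X]) * C κ ^ n * (Q' * scale q Q'))) := by
    linear_combination h1
  have h3 := mul_left_cancel₀ (pow_ne_zero n X_ne_zero) h2
  -- Comparison of lowest terms at z = 0. If v has a pole there, cancellation would require qᵖ = qⁿ;
  -- otherwise σv - v vanishes at 0, so r = 0.
  rcases lt_or_ge p n with hpn | hpn
  · obtain ⟨d, rfl⟩ := Nat.exists_eq_add_of_lt hpn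
    rw [show p + d + 1 = p + (d + 1) by ring, pow_add X p, mul_assoc (X ^ p)] at h3
    have h4 := congrArg (eval 0) (mul_left_cancel₀ (pow_ne_zero p X_ne_zero) h3)
    simp only [eval_sub, eval_mul, eval_pow, eval_C, eval_X, hsc0, zero_pow (Nat.succ_ne_zero d),
      zero_mul] at h4
    have h5 : κ ^ p = κ ^ (p + (d + 1)) := by
      refine mul_right_cancel₀ (mul_ne_zero hP0 hQ0') ?_
      linear_combination h4
    rw [hκ, ← map_pow, ← map_pow] at h5
    have h6 := zpow_injective hq (a₁ := p) (a₂ := ((p + (d + 1) : ℕ) : ℤ))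
      (by simpa only [zpow_natCast] using (algebraMap ℂ (CE q)).injective h5)
    omega
  · obtain ⟨d, rfl⟩ := Nat.exists_eq_add_of_le hpn
    rw [pow_add X n, mul_assoc (X ^ n)] at h3
    have h4 := congrArg (eval 0) (mul_left_cancel₀ (pow_ne_zero n X_ne_zero) h3)
    simp only [eval_sub, eval_mul, eval_pow, eval_C, eval_X, hsc0, eval_intCast] at h4
    have h5 : (0 : CE q) ^ d * (κ ^ (n + d) - κ ^ n) = 0 := by
      rcases d with _ | d <;> simp
    have h6 : (r : CE q) * κ ^ n * (Q'.eval 0 * Q'.eval 0) = 0 := by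
      linear_combination -h4 + P'.eval 0 * Q'.eval 0 * h5
    exact mul_ne_zero (mul_ne_zero hr' (pow_ne_zero n hκ0)) (mul_ne_zero hQ0' hQ0') h6

end Poles

/-! ### Rational functions modulo σ(g)/g. -/

section NormalForm

variable {q : ℂˣ}

/-- Two complex numbers are equivalent when they differ by a power of `q`. -/
def orbitSetoid (q : ℂˣ) : Setoid ℂ where
  r x y := ∃ k : ℤ, y = (q : ℂ) ^ k * x
  iseqv :=
    { refl := fun x => ⟨0, by simp⟩
      symm := by
        rintro x y ⟨k, rfl⟩
        exact ⟨-k, by rw [← mul_assoc, ← zpow_add₀ q.ne_zero]; simp⟩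
      trans := by
        rintro x y w ⟨k, rfl⟩ ⟨j, rfl⟩
        exact ⟨j + k, by rw [← mul_assoc, ← zpow_add₀ q.ne_zero]⟩ }

/-- A chosen representative of each orbit under multiplication by `q`. -/
def orbitRep (q : ℂˣ) (x : ℂ) : ℂ := (Quotient.mk (orbitSetoid q) x).out

theorem exists_orbitRep_eq (q : ℂˣ) (x : ℂ) : ∃ k : ℤ, orbitRep q x = (q : ℂ) ^ k * x :=
  (orbitSetoid q).symm (@Quotient.mk_out _ (orbitSetoid q) x)

theorem orbitRep_zpow_mul (k : ℤ) (x : ℂ) : orbitRep q ((q : ℂ) ^ k * x) = orbitRep q x := by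
  have h : (orbitSetoid q).r x ((q : ℂ) ^ k * x) := ⟨k, rfl⟩
  rw [orbitRep, orbitRep, (Quotient.sound h).symm]

theorem orbitRep_orbitRep (x : ℂ) : orbitRep q (orbitRep q x) = orbitRep q x := by
  obtain ⟨k, hk⟩ := exists_orbitRep_eq q x
  conv_lhs => rw [hk]
  exact orbitRep_zpow_mul k x

/-- The product of the `(z - β) ^ n β`. -/
def divisorProd (n : ℂ →₀ ℤ) : Mer := n.prod fun β k => (z - algebraMap ℂ Mer β) ^ k

theorem divisorProd_zero : divisorProd 0 = 1 := Finsupp.prod_zero_index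

theorem divisorProd_add (m n : ℂ →₀ ℤ) : divisorProd (m + n) = divisorProd m * divisorProd n :=
  Finsupp.prod_add_index' (fun _ => zpow_zero _) fun β _ _ => zpow_add₀ (z_sub_ne_zero β) _ _

theorem divisorProd_neg (n : ℂ →₀ ℤ) : divisorProd (-n) = (divisorProd n)⁻¹ := by
  refine eq_inv_of_mul_eq_one_left ?_
  rw [← divisorProd_add, neg_add_cancel, divisorProd_zero]

theorem dlog_divisorProd (n : ℂ →₀ ℤ) :
    dlog (divisorProd n) = ∑ β ∈ n.support, n β * (z * (z - algebraMap ℂ Mer β)⁻¹) := by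
  classical
  have key : ∀ s : Finset ℂ, dlog (∏ β ∈ s, (z - algebraMap ℂ Mer β) ^ n β) =
      ∑ β ∈ s, n β * (z * (z - algebraMap ℂ Mer β)⁻¹) := by
    intro s
    induction s using Finset.induction_on with
    | empty => simp
    | insert β s hβ ih =>
      rw [Finset.prod_insert hβ, Finset.sum_insert hβ, dlog_mul (zpow_ne_zero _ (z_sub_ne_zero β))
        (Finset.prod_ne_zero_iff.2 fun β _ => zpow_ne_zero _ (z_sub_ne_zero β)), ih,
        dlog_zpow (z_sub_ne_zero β), dlog, map_sub, del_z, Derivation.map_algebraMap, sub_zero,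
        div_eq_mul_inv]
  exact key _

/-- `a` is, up to a factor `μ z ^ r σ(g) / g`, the product of the `(z - β) ^ n β`, where the
zeros and poles `β` lie in distinct `q`-orbits. -/
def HasNormalForm (q : ℂˣ) (a : Mer) : Prop :=
  ∃ μ : ℂ, μ ≠ 0 ∧ ∃ r : ℤ, ∃ g ∈ K, g ≠ 0 ∧ ∃ n : ℂ →₀ ℤ,
    (∀ β ∈ n.support, β ≠ 0 ∧ orbitRep q β = β) ∧
    a = algebraMap ℂ Mer μ * z ^ r * (sigma q g / g) * divisorProd n

theorem HasNormalForm.mul {a b : Mer} (ha : HasNormalForm q a) (hb : HasNormalForm q b) :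
    HasNormalForm q (a * b) := by
  classical
  obtain ⟨μ, hμ, r, g, hg, hg0, n, hn, rfl⟩ := ha
  obtain ⟨μ', hμ', r', g', hg', hg0', n', hn', rfl⟩ := hb
  refine ⟨μ * μ', mul_ne_zero hμ hμ', r + r', g * g', mul_mem hg hg', mul_ne_zero hg0 hg0',
    n + n', fun β hβ => ?_, ?_⟩
  · rcases Finset.mem_union.1 (Finsupp.support_add hβ) with h | h
    · exact hn β h
    · exact hn' β h
  · rw [divisorProd_add, map_mul, map_mul, zpow_add₀ z_ne_zero, mul_div_mul_comm]
    ring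

theorem HasNormalForm.inv {a : Mer} (ha : HasNormalForm q a) : HasNormalForm q a⁻¹ := by
  obtain ⟨μ, hμ, r, g, hg, hg0, n, hn, rfl⟩ := ha
  refine ⟨μ⁻¹, inv_ne_zero hμ, -r, g⁻¹, inv_mem hg, inv_ne_zero hg0, -n, ?_, ?_⟩
  · rwa [Finsupp.support_neg]
  · rw [divisorProd_neg, map_inv₀, map_inv₀, zpow_neg, mul_inv, mul_inv, mul_inv, inv_div,
      inv_div_inv]

theorem hasNormalForm_algebraMap {c : ℂ} (hc : c ≠ 0) : HasNormalForm q (algebraMap ℂ Mer c) :=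
  ⟨c, hc, 0, 1, one_mem _, one_ne_zero, 0, by simp, by simp [divisorProd_zero]⟩

theorem hasNormalForm_one : HasNormalForm q 1 := by
  simpa using hasNormalForm_algebraMap (q := q) one_ne_zero

theorem hasNormalForm_z : HasNormalForm q z :=
  ⟨1, one_ne_zero, 1, 1, one_mem _, one_ne_zero, 0, by simp, by simp [divisorProd_zero]⟩

theorem hasNormalForm_sigma_div {g : Mer} (hg : g ∈ K) (hg0 : g ≠ 0) :
    HasNormalForm q (sigma q g / g) :=
  ⟨1, one_ne_zero, 0, g, hg, hg0, 0, by simp, by simp [divisorProd_zero]⟩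

/-- The quotient σ(g)/g is absorbed by the normal form; this lets a root be moved along its orbit.
-/
theorem HasNormalForm.sigma_iff {g : Mer} (hg : g ∈ K) (hg0 : g ≠ 0) :
    HasNormalForm q (sigma q g) ↔ HasNormalForm q g := by
  have h := hasNormalForm_sigma_div (q := q) hg hg0
  constructor
  · intro h1
    have h2 := h.inv.mul h1
    rwa [inv_div, div_mul_cancel₀ _ ((map_ne_zero _).2 hg0)] at h2
  · intro h1
    have h2 := h.mul h1
    rwa [div_mul_cancel₀ _ hg0] at h2

theorem hasNormalForm_z_sub (β : ℂ) : HasNormalForm q (z - algebraMap ℂ Mer β) := by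
  classical
  by_cases hβ : β = 0
  · simpa [hβ] using hasNormalForm_z
  obtain ⟨k, hk⟩ := exists_orbitRep_eq q β
  set γ := orbitRep q β with hγ
  have hγ0 : γ ≠ 0 := by
    rw [hk]; exact mul_ne_zero (zpow_ne_zero k q.ne_zero) hβ
  -- These satisfy σ(t k) = t (k + 1). They link z - γ = t 0 to a scalar multiple of z - β, which is
  -- t k when γ = qᵏβ.
  let t : ℤ → Mer := fun k => algebraMap ℂ Mer ((q : ℂ) ^ k) * z - algebraMap ℂ Mer γ
  have htK : ∀ k, t k ∈ K := fun k =>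
    sub_mem (mul_mem (K.algebraMap_mem _) z_mem_K) (K.algebraMap_mem _)
  have hteq : ∀ k, t k = algebraMap ℂ Mer ((q : ℂ) ^ k) *
      (z - algebraMap ℂ Mer ((q : ℂ) ^ (-k) * γ)) := fun k => by
    simp only [t]
    rw [mul_sub, ← map_mul, ← mul_assoc, ← zpow_add₀ q.ne_zero]
    simp
  have hqk : ∀ k : ℤ, (q : ℂ) ^ k ≠ 0 := fun k => zpow_ne_zero k q.ne_zero
  have ht0 : ∀ k, t k ≠ 0 := fun k => by
    rw [hteq]
    exact mul_ne_zero ((map_ne_zero _).2 (hqk k)) (z_sub_ne_zero _)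
  have htσ : ∀ k, sigma q (t k) = t (k + 1) := fun k => by
    simp only [t]
    rw [map_sub, map_mul, AlgEquiv.commutes, AlgEquiv.commutes, sigma_z, ← mul_assoc, ← map_mul,
      zpow_add_one₀ q.ne_zero]
  have h0 : HasNormalForm q (t 0) := by
    refine ⟨1, one_ne_zero, 0, 1, one_mem _, one_ne_zero, Finsupp.single γ 1, fun β' hβ' => ?_, ?_⟩
    · rw [Finset.mem_singleton.1 (Finsupp.support_single_subset hβ')]
      exact ⟨hγ0, orbitRep_orbitRep β⟩
    · rw [divisorProd, Finsupp.prod_single_index (zpow_zero _)]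
      simp [t]
  have hall : ∀ k, HasNormalForm q (t k) := fun k => by
    induction k using Int.induction_on with
    | zero => exact h0
    | succ i ih => rw [← htσ]; exact (HasNormalForm.sigma_iff (htK _) (ht0 _)).2 ih
    | pred i ih =>
      rw [← HasNormalForm.sigma_iff (htK _) (ht0 _), htσ]
      simpa using ih
  have h1 := ((hasNormalForm_algebraMap (q := q) (hqk k)).inv).mul (hall k)
  rw [hteq, inv_mul_cancel_left₀ ((map_ne_zero _).2 (hqk k)), hk, ← mul_assoc,
    ← zpow_add₀ q.ne_zero] at h1
  simpa using h1

theorem hasNormalForm_aeval {P : Polynomial ℂ} (hP : P ≠ 0) :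
    HasNormalForm q (Polynomial.aeval z P) := by
  have key : ∀ s : Multiset ℂ, HasNormalForm q
      (Polynomial.aeval z (s.map fun β => Polynomial.X - Polynomial.C β).prod) := by
    intro s
    induction s using Multiset.induction_on with
    | empty => simpa using hasNormalForm_one
    | cons β s ih =>
      rw [Multiset.map_cons, Multiset.prod_cons, map_mul]
      refine HasNormalForm.mul ?_ ih
      rw [map_sub, Polynomial.aeval_X, Polynomial.aeval_C]
      exact hasNormalForm_z_sub β
  rw [(IsAlgClosed.splits P).eq_prod_roots, map_mul, Polynomial.aeval_C]
  exact (hasNormalForm_algebraMap (Polynomial.leadingCoeff_ne_zero.2 hP)).mul (key _)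

theorem hasNormalForm_of_mem_K {a : Mer} (ha : a ∈ K) (ha0 : a ≠ 0) : HasNormalForm q a := by
  obtain ⟨P, Q, rfl⟩ := (IntermediateField.mem_adjoin_simple_iff ℂ a).1 ha
  have hP : P ≠ 0 := by rintro rfl; simp at ha0
  have hQ : Q ≠ 0 := by rintro rfl; simp at ha0
  rw [div_eq_mul_inv]
  exact (hasNormalForm_aeval hP).mul (hasNormalForm_aeval hQ).inv

end NormalForm

/-! ### Existence of telescopers for logarithmic derivatives. -/

section Telescoper

variable {q : ℂˣ}

/-- `b` satisfies a nontrivial relation `∑ i < N, l i * ∂ⁱ b = σ v - v` with `σ`-invariant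
coefficients and `v` in `C_E(z)`. -/
def HasTelescoper (q : ℂˣ) (N : ℕ) (b : Mer) : Prop :=
  ∃ l : ℕ → Mer, (∀ i, l i ∈ CE q) ∧ (∃ i < N, l i ≠ 0) ∧ ∃ v ∈ KE q,
    ∑ i ∈ Finset.range N, l i * del^[i] b = sigma q v - v

theorem del_iterate_mem_of_mem_KE {φ : Mer} (h : φ ∈ KE q) {l : ℕ → Mer} (hl : ∀ i, l i ∈ CE q)
    (N : ℕ) : ∑ i ∈ Finset.range N, l i * del^[i] φ ∈ KE q :=
  sum_mem fun i _ => mul_mem (CE_le_KE (hl i)) (del_iterate_mem_KE h i)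

/-- The operator Σ lᵢ ∂ⁱ has invariant coefficients, so it commutes with σ and its value on σu - u
is absorbed into v. -/
theorem HasTelescoper.of_add {N : ℕ} {b u : Mer} (hu : u ∈ KE q)
    (h : HasTelescoper q N (b + (sigma q u - u))) : HasTelescoper q N b := by
  obtain ⟨l, hl, hl0, v, hv, h⟩ := h
  refine ⟨l, hl, hl0, v - ∑ i ∈ Finset.range N, l i * del^[i] u,
    sub_mem hv (del_iterate_mem_of_mem_KE hu hl N), ?_⟩
  have h1 : sigma q (∑ i ∈ Finset.range N, l i * del^[i] u) =
      ∑ i ∈ Finset.range N, l i * del^[i] (sigma q u) := by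
    rw [map_sum]
    refine Finset.sum_congr rfl fun i _ => ?_
    rw [map_mul, mem_CE.1 (hl i), del_iterate_sigma]
  have h2 : ∀ i, del^[i] (b + (sigma q u - u)) + del^[i] u = del^[i] b + del^[i] (sigma q u) := by
    intro i
    rw [← del_iterate_add, ← del_iterate_add]
    congr 1
    ring
  have h3 : ∑ i ∈ Finset.range N, l i * del^[i] (b + (sigma q u - u)) +
      ∑ i ∈ Finset.range N, l i * del^[i] u = ∑ i ∈ Finset.range N, l i * del^[i] b +
      ∑ i ∈ Finset.range N, l i * del^[i] (sigma q u) := by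
    rw [← Finset.sum_add_distrib, ← Finset.sum_add_distrib]
    refine Finset.sum_congr rfl fun i _ => ?_
    rw [← mul_add, h2, mul_add]
  rw [map_sub, h1]
  linear_combination h - h3

theorem not_hasTelescoper (hq : ‖(q : ℂ)‖ ≠ 1) {n : ℂ →₀ ℤ} (hn0 : n ≠ 0)
    (hn : ∀ β ∈ n.support, β ≠ 0 ∧ orbitRep q β = β) (r : ℤ) (N : ℕ) :
    ¬ HasTelescoper q N (r + dlog (divisorProd n)) := by
  classical
  rintro ⟨l, hl, hl0, v, hv, h⟩
  obtain ⟨c, hc⟩ := Finsupp.support_nonempty_iff.2 hn0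
  obtain ⟨hc0, hcr⟩ := hn c hc
  have hint : ∀ (k : ℤ) (d : ℂ), (k : Mer) ∈ reg q d := fun k d => intCast_mem _ k
  have hzreg : ∀ d : ℂ, z ∈ reg q d := fun d => by
    simpa using aeval_mem_reg (q := q) Polynomial.X d
  have hterm : ∀ β d : ℂ, d ≠ β → (n β : Mer) * (z * (z - algebraMap ℂ Mer β)⁻¹) ∈ reg q d :=
    fun β d hd => mul_mem (hint _ d) (mul_mem (hzreg d)
      ((isRegUnit_z_sub hd).inv (z_sub_ne_zero β)).mem_reg)
  refine no_telescoper hq hc0 ?_ ?_ hl N hl0 hv h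
  · rw [dlog_divisorProd, ← Finset.add_sum_erase _ _ hc]
    have hncCE : ((n c : ℤ) : Mer) ∈ CE q := intCast_mem _ _
    have hnc0 : ((n c : ℤ) : Mer) ≠ 0 := Int.cast_ne_zero.2 (Finsupp.mem_support_iff.1 hc)
    -- Times z - c, the function is n(c) z plus a multiple of z - c by something regular at c: a
    -- simple pole.
    have h1 := ((isRegUnit_of_mem_CE hncCE hnc0 c).mul (isRegUnit_z hc0)).add_mul
      (add_mem (hint r c) (sum_mem fun β (hβ : β ∈ n.support.erase c) =>
        hterm β c (Finset.ne_of_mem_erase hβ).symm))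
    convert h1 using 1
    have := z_sub_ne_zero c
    field_simp
    ring
  · intro k hk
    rw [dlog_divisorProd]
    refine add_mem (hint r _) (sum_mem fun β hβ => hterm β _ ?_)
    -- A second pole on the orbit of c would be another chosen representative of that orbit.
    rintro rfl
    have h2 := (hn _ hβ).2
    rw [orbitRep_zpow_mul, hcr] at h2
    have h3 : (q : ℂ) ^ k = (q : ℂ) ^ (0 : ℤ) := by
      rw [zpow_zero]
      exact mul_right_cancel₀ hc0 (by rw [one_mul]; exact h2.symm)
    exact hk (zpow_injective hq h3)

theorem dlog_mul_zpow_mul_sigma_div {μ : ℂ} (hμ : μ ≠ 0) (r : ℤ) {g : Mer} (hg0 : g ≠ 0) :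
    dlog (algebraMap ℂ Mer μ * z ^ r * (sigma q g / g)) =
      r + (sigma q (dlog g) - dlog g) := by
  have hσg : sigma q g ≠ 0 := (map_ne_zero _).2 hg0
  have hμ' : algebraMap ℂ Mer μ ≠ 0 := (map_ne_zero _).2 hμ
  have hz := zpow_ne_zero r z_ne_zero
  rw [dlog_mul (mul_ne_zero hμ' hz) (div_ne_zero hσg hg0), dlog_mul hμ' hz, dlog_algebraMap,
    dlog_zpow z_ne_zero, dlog_z, dlog_div hσg hg0, dlog_sigma]
  ring

theorem exists_of_hasTelescoper (hq : ‖(q : ℂ)‖ ≠ 1) {a : Mer} (ha : a ∈ K) (ha0 : a ≠ 0) {N : ℕ}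
    (h : HasTelescoper q N (dlog a)) :
    ∃ μ : ℂ, μ ≠ 0 ∧ ∃ r : ℤ, ∃ g ∈ K, g ≠ 0 ∧
      a = algebraMap ℂ Mer μ * z ^ r * (sigma q g / g) := by
  obtain ⟨μ, hμ, r, g, hg, hg0, n, hn, rfl⟩ := hasNormalForm_of_mem_K (q := q) ha ha0
  by_cases hn0 : n = 0
  · exact ⟨μ, hμ, r, g, hg, hg0, by rw [hn0, divisorProd_zero, mul_one]⟩
  · rw [dlog_mul (left_ne_zero_of_mul ha0) (right_ne_zero_of_mul ha0),
      dlog_mul_zpow_mul_sigma_div hμ r hg0, add_right_comm] at h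
    exact absurd (h.of_add (dlog_mem_KE (K_le_KE hg))) (not_hasTelescoper hq hn0 hn r N)

theorem exists_of_hasTelescoper_one (hq : ‖(q : ℂ)‖ ≠ 1) {a : Mer} (ha : a ∈ K) (ha0 : a ≠ 0)
    (h : HasTelescoper q 1 (dlog a)) :
    ∃ μ : ℂ, μ ≠ 0 ∧ ∃ g ∈ K, g ≠ 0 ∧ a = algebraMap ℂ Mer μ * (sigma q g / g) := by
  obtain ⟨μ, hμ, r, g, hg, hg0, rfl⟩ := exists_of_hasTelescoper hq ha ha0 h
  rw [dlog_mul_zpow_mul_sigma_div hμ r hg0] at h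
  obtain ⟨l, hl, ⟨i, hi, hi0⟩, v, hv, h⟩ := h.of_add (dlog_mem_KE (K_le_KE hg))
  obtain rfl : i = 0 := by omega
  have hr : r = 0 := by
    refine int_eq_zero_of_eq_sigma_sub hq (v := v / l 0) (div_mem hv (CE_le_KE (hl 0))) ?_
    rw [map_div₀, mem_CE.1 (hl 0), ← sub_div, ← h]
    simp [hi0]
  exact ⟨μ, hμ, g, hg, hg0, by rw [hr, zpow_zero, mul_one]⟩

end Telescoper

/-! ### From algebraic dependence to telescopers, and explicit relations. -/

section Independence

variable {q : ℂˣ}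

theorem del_mem_adjoin {x : ℕ → Mer} (hx0 : del (x 0) = x 0 * x 1)
    (hx : ∀ n, del (x (n + 1)) = x (n + 2)) {n : ℕ} {φ : Mer}
    (h : φ ∈ Algebra.adjoin (KE q) (x '' Set.Iio (n + 1))) :
    del φ ∈ Algebra.adjoin (KE q) (x '' Set.Iio (n + 2)) := by
  have hle : Algebra.adjoin (KE q) (x '' Set.Iio (n + 1)) ≤
      Algebra.adjoin (KE q) (x '' Set.Iio (n + 2)) :=
    Algebra.adjoin_mono (Set.image_mono (Set.Iio_subset_Iio (Nat.le_succ _)))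
  have hgen : ∀ i < n + 2, x i ∈ Algebra.adjoin (KE q) (x '' Set.Iio (n + 2)) := fun i hi =>
    Algebra.subset_adjoin ⟨i, hi, rfl⟩
  induction h using Algebra.adjoin_induction with
  | mem y hy =>
    obtain ⟨i, hi, rfl⟩ := hy
    have hi' : i < n + 1 := hi
    cases i with
    | zero => rw [hx0]; exact mul_mem (hgen 0 (by omega)) (hgen 1 (by omega))
    | succ i => rw [hx]; exact hgen _ (by omega)
  | algebraMap c =>
    exact Subalgebra.algebraMap_mem _ (⟨del (c : Mer), del_mem_KE c.2⟩ : KE q)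
  | add φ ψ _ _ hφ hψ => rw [map_add]; exact add_mem hφ hψ
  | mul φ ψ h1 h2 hφ hψ =>
    rw [Derivation.leibniz]
    exact add_mem (mul_mem (hle h1) hψ) (mul_mem (hle h2) hφ)

/-- The family `f, ∂f/f, ∂(∂f/f), …`. -/
def dlogSeq (f : Mer) : ℕ → Mer
  | 0 => f
  | n + 1 => del^[n] (dlog f)

theorem del_iterate_triangular {f : Mer} (hf0 : f ≠ 0) (n : ℕ) :
    ∃ u ∈ Algebra.adjoin (KE q) (dlogSeq f '' Set.Iio n), u ≠ 0 ∧
      ∃ v ∈ Algebra.adjoin (KE q) (dlogSeq f '' Set.Iio n),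
        del^[n] f = u * dlogSeq f n + v := by
  have hx0 : del (dlogSeq f 0) = dlogSeq f 0 * dlogSeq f 1 := by
    simp [dlogSeq, dlog, mul_div_cancel₀ _ hf0]
  have hx : ∀ n, del (dlogSeq f (n + 1)) = dlogSeq f (n + 2) := fun n => by
    simp only [dlogSeq, Function.iterate_succ_apply']
  cases n with
  | zero => exact ⟨1, one_mem _, one_ne_zero, 0, zero_mem _, by simp [dlogSeq]⟩
  | succ n =>
    refine ⟨f, Algebra.subset_adjoin ⟨0, Nat.succ_pos n, rfl⟩, hf0, ?_⟩
    induction n with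
    | zero => exact ⟨0, zero_mem _, by simpa [dlogSeq] using hx0⟩
    | succ n ih =>
      obtain ⟨v, hv, h⟩ := ih
      have hgen : ∀ i < n + 2, dlogSeq f i ∈
          Algebra.adjoin (KE q) (dlogSeq f '' Set.Iio (n + 2)) := fun i hi =>
        Algebra.subset_adjoin ⟨i, hi, rfl⟩
      -- Differentiating ∂ⁿ⁺¹f = f ∂ⁿy + v gives f ∂ⁿ⁺¹y plus this remainder, where ∂f = f y.
      refine ⟨dlogSeq f 0 * dlogSeq f 1 * dlogSeq f (n + 1) + del v,
        add_mem (mul_mem (mul_mem (hgen 0 (by omega)) (hgen 1 (by omega)))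
          (hgen (n + 1) (by omega))) (del_mem_adjoin hx0 hx hv), ?_⟩
      rw [Function.iterate_succ_apply', h, map_add, Derivation.leibniz, hx, smul_eq_mul,
        smul_eq_mul]
      change _ + _ * del (dlogSeq f 0) + _ = _
      rw [hx0]
      ring

instance : CharZero (KE q) := charZero_of_injective_algebraMap (algebraMap ℂ (KE q)).injective

theorem hasTelescoper_of_exists {N : ℕ} {b : Mer} (hb : b ∈ KE q)
    (h : ∃ l : Fin N → KE q, l ≠ 0 ∧ (∀ i, sigmaKE q (l i) = l i) ∧
      ∃ v, ∑ i, l i * ⟨del^[i] b, del_iterate_mem_KE hb i⟩ = sigmaKE q v - v) :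
    HasTelescoper q N b := by
  obtain ⟨l, hl0, hl, v, h⟩ := h
  refine ⟨fun i => if hi : i < N then (l ⟨i, hi⟩ : Mer) else 0, fun i => ?_, ?_, v, v.2, ?_⟩
  · dsimp only
    split_ifs with hi
    · exact congrArg Subtype.val (hl ⟨i, hi⟩)
    · exact zero_mem _
  · obtain ⟨i, hi⟩ := Function.ne_iff.1 hl0
    exact ⟨i, i.2, by simpa using hi⟩
  · rw [Finset.sum_range]
    have h1 := congrArg Subtype.val h
    simp only [Fin.is_lt, dite_true]
    rw [AddSubmonoidClass.coe_finsetSum] at h1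
    exact h1

theorem hasTelescoper_of_not_algebraicIndepOn {a f : Mer} (ha : a ∈ K) (ha0 : a ≠ 0) (hf0 : f ≠ 0)
    (hf : sigma q f = a * f) (N : ℕ) (hN : 0 < N)
    (h : ¬ AlgebraicIndepOn (KE q) (fun n : ℕ => del^[n] f) (Set.Iio (N + 1))) :
    HasTelescoper q N (dlog a) := by
  have haKE : a ∈ KE q := K_le_KE ha
  have hb : dlog a ∈ KE q := dlog_mem_KE haKE
  have hs : ∀ c : KE q, (sigma q : Mer →+* Mer) (algebraMap (KE q) Mer c) =
      algebraMap (KE q) Mer (sigmaKE q c) := fun _ => rfl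
  have hy : ∀ i : Fin N, (sigma q : Mer →+* Mer) (del^[i] (dlog f)) = del^[i] (dlog f) +
      algebraMap (KE q) Mer ⟨del^[i] (dlog a), del_iterate_mem_KE hb i⟩ := fun i => by
    change sigma q _ = _ + del^[i] (dlog a)
    rw [← del_iterate_sigma, ← dlog_sigma, hf, dlog_mul ha0 hf0, del_iterate_add, add_comm]
  by_cases hind : AlgebraicIndependent (KE q) fun i : Fin N => del^[i] (dlog f)
  -- If f were also transcendental over the ∂ⁱy, then f, y, …, ∂ᴺ⁻¹y would be independent, and with
  -- them f, …, ∂ᴺf.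
  · by_cases htr : Transcendental (Algebra.adjoin (KE q)
        (Set.range fun i : Fin N => del^[i] (dlog f))) f
    · refine absurd (algebraicIndepOn_of_triangular (del_iterate_triangular hf0) _ ?_) h
      have h1 := (hind.option_iff_transcendental f).2 htr
      have h2 := h1.comp (fun i : Set.Iio (N + 1) => finSuccEquiv N ⟨i, i.2⟩)
        fun i j hij => Subtype.ext (congrArg Fin.val ((finSuccEquiv N).injective hij))
      change AlgebraicIndependent (KE q) fun i : Set.Iio (N + 1) => dlogSeq f i
      convert h2 using 1
      funext i
      obtain ⟨i, hi⟩ := i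
      cases i with
      | zero => rfl
      | succ i =>
        have hi' : i < N := Nat.lt_of_succ_lt_succ hi
        exact (congrArg (fun o : Option (Fin N) => o.elim f fun i => del^[i] (dlog f))
          (finSuccEquiv_succ (⟨i, hi'⟩ : Fin N))).symm
    · obtain ⟨c, hc0, j, k, hjk, h1⟩ := exists_of_not_transcendental MonomialOrder.lex hs hy hind
        (a := ⟨a, haKE⟩) hf0 hf htr
      have hc0' : (c : Mer) ≠ 0 := by simpa using hc0
      have h1' : sigma q c * a ^ j = c * a ^ k := by
        have := congrArg (algebraMap (KE q) Mer) h1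
        rwa [map_mul, map_mul, map_pow, map_pow] at this
      have h2 := congrArg dlog h1'
      rw [dlog_mul ((map_ne_zero _).2 hc0') (pow_ne_zero j ha0),
        dlog_mul hc0' (pow_ne_zero k ha0), dlog_pow ha0, dlog_pow ha0, dlog_sigma] at h2
      -- The logarithmic derivative of σ(c) aʲ = c aᵏ is (k - j) b = σ(dlog c) - dlog c.
      refine ⟨fun i => if i = 0 then (((k : ℤ) - j : ℤ) : Mer) else 0, fun i => ?_,
        ⟨0, hN, ?_⟩, dlog c, dlog_mem_KE c.2, ?_⟩
      · dsimp only
        split_ifs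
        · exact intCast_mem _ _
        · exact zero_mem _
      · dsimp only
        rw [if_pos rfl, Int.cast_ne_zero]
        omega
      · simp only [ite_mul, zero_mul]
        rw [Finset.sum_ite_eq' (Finset.range N) 0, if_pos (Finset.mem_range.2 hN)]
        push_cast
        rw [Function.iterate_zero_apply]
        linear_combination -h2
  · exact hasTelescoper_of_exists hb
      (exists_linear_of_not_algebraicIndependent MonomialOrder.lex hs hy hind)

theorem algebraicIndepOn_Iio_two {L : IntermediateField ℂ Mer} {w : ℕ → Mer}
    (h : AlgebraicIndepOn L w (Set.Iio 2)) : AlgebraicIndependent L ![w 0, w 1] := by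
  have h1 := h.comp (fun i : Fin 2 => (⟨i, i.2⟩ : Set.Iio 2)) fun i j hij => by
    simpa [Subtype.ext_iff, Fin.ext_iff] using hij
  convert h1 using 1
  funext i
  fin_cases i <;> rfl

theorem algebraicIndepOn_Iio_three {L : IntermediateField ℂ Mer} {w : ℕ → Mer}
    (h : AlgebraicIndepOn L w (Set.Iio 3)) : AlgebraicIndependent L ![w 0, w 1, w 2] := by
  have h1 := h.comp (fun i : Fin 3 => (⟨i, i.2⟩ : Set.Iio 3)) fun i j hij => by
    simpa [Subtype.ext_iff, Fin.ext_iff] using hij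
  convert h1 using 1
  funext i
  fin_cases i <;> rfl

open MvPolynomial in
theorem not_algebraicIndependent_of_del_eq {L : IntermediateField ℂ Mer} {f u : Mer}
    (hu : u ∈ L) (h : del f = u * f) : ¬ AlgebraicIndependent L ![f, del f] := by
  intro hind
  have h1 := (algebraicIndependent_iff.1 hind) (X 1 - C (⟨u, hu⟩ : L) * X 0) (by
    rw [map_sub, map_mul, aeval_X, aeval_X, aeval_C]
    exact sub_eq_zero.2 h)
  have h2 := congrArg (eval (![0, 1] : Fin 2 → L)) h1
  simp at h2

open MvPolynomial in
theorem not_algebraicIndependent_of_del_dlog {L : IntermediateField ℂ Mer} {f u : Mer}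
    (hf0 : f ≠ 0) (hu : u ∈ L) (h : del (dlog f) = u) :
    ¬ AlgebraicIndependent L ![f, del f, del (del f)] := by
  intro hind
  have h1 := (algebraicIndependent_iff.1 hind)
    -- This is ∂(∂f/f) = u with denominators cleared; its value -1 at (0, 1, 0) shows that it is not
    -- the zero polynomial.
    (X 0 * X 2 - X 1 ^ 2 - C (⟨u, hu⟩ : L) * X 0 ^ 2) (by
    simp only [map_sub, map_mul, map_pow, aeval_X, aeval_C]
    change f * del (del f) - del f ^ 2 - u * f ^ 2 = 0
    rw [← h, dlog, Derivation.leibniz_div]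
    simp only [smul_eq_mul]
    field_simp
    ring)
  have h2 := congrArg (eval (![0, 1, 0] : Fin 3 → L)) h1
  simp at h2

theorem dlog_sub_dlog_sigma {a f g : Mer} {μ : ℂ} (hμ : μ ≠ 0) {r : ℤ} (hg0 : g ≠ 0) (hf0 : f ≠ 0)
    (hf : sigma q f = a * f) (ha : a = algebraMap ℂ Mer μ * z ^ r * (sigma q g / g)) :
    sigma q (dlog f - dlog g) = dlog f - dlog g + r := by
  have ha0 : a ≠ 0 := by
    rintro rfl
    rw [zero_mul, map_eq_zero] at hf
    exact hf0 hf
  have h := dlog_mul_zpow_mul_sigma_div (q := q) hμ r hg0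
  rw [← ha] at h
  rw [map_sub, ← dlog_sigma, hf, dlog_mul ha0 hf0, h]
  ring

end Independence

end QDiff

end

theorem mainTheorem4 (q : ℂˣ) (hq : ‖(q : ℂ)‖ ≠ 1) (a f : QDiff.Mer)
    (ha : a ∈ QDiff.K) (ha0 : a ≠ 0) (hf0 : f ≠ 0) (hf : QDiff.sigma q f = a * f) :
    (¬ AlgebraicIndependent (QDiff.KE q) ![f, QDiff.del f] ↔
      ∃ μ : ℂ, μ ≠ 0 ∧ ∃ g ∈ QDiff.K, g ≠ 0 ∧
        a = algebraMap ℂ QDiff.Mer μ * (QDiff.sigma q g / g)) ∧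
    (¬ AlgebraicIndependent (QDiff.KE q) ![f, QDiff.del f, QDiff.del (QDiff.del f)] ↔
      ∃ μ : ℂ, μ ≠ 0 ∧ ∃ r : ℤ, ∃ g ∈ QDiff.K, g ≠ 0 ∧
        a = algebraMap ℂ QDiff.Mer μ * QDiff.z ^ r * (QDiff.sigma q g / g)) ∧
    ((¬ ∃ μ : ℂ, μ ≠ 0 ∧ ∃ g ∈ QDiff.K, g ≠ 0 ∧
        a = algebraMap ℂ QDiff.Mer μ * (QDiff.sigma q g / g)) →
      (¬ ∃ μ : ℂ, μ ≠ 0 ∧ ∃ r : ℤ, ∃ g ∈ QDiff.K, g ≠ 0 ∧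
        a = algebraMap ℂ QDiff.Mer μ * QDiff.z ^ r * (QDiff.sigma q g / g)) →
      QDiff.Hypertranscendental (QDiff.KE q) f) := by
  open QDiff in
  refine ⟨⟨fun h => ?_, ?_⟩, ⟨fun h => ?_, ?_⟩, fun _ h => ?_⟩
  · exact exists_of_hasTelescoper_one hq ha ha0 (hasTelescoper_of_not_algebraicIndepOn ha ha0 hf0 hf
      1 one_pos fun h' => h (algebraicIndepOn_Iio_two (w := fun n => del^[n] f) h'))
  · rintro ⟨μ, hμ, g, hg, hg0, hag⟩
    have h1 : dlog f - dlog g ∈ CE q := by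
      have := dlog_sub_dlog_sigma (r := 0) hμ hg0 hf0 hf (by rw [hag, zpow_zero, mul_one])
      rwa [Int.cast_zero, add_zero] at this
    refine not_algebraicIndependent_of_del_eq (u := dlog f) ?_ (div_mul_cancel₀ _ hf0).symm
    have := add_mem (CE_le_KE h1) (dlog_mem_KE (K_le_KE hg))
    rwa [sub_add_cancel] at this
  · exact exists_of_hasTelescoper hq ha ha0 (hasTelescoper_of_not_algebraicIndepOn ha ha0 hf0 hf
      2 two_pos fun h' => h (algebraicIndepOn_Iio_three (w := fun n => del^[n] f) h'))
  · rintro ⟨μ, hμ, r, g, hg, hg0, hag⟩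
    -- σ adds the constant r to `dlog f - dlog g`, and ∂ kills r.
    have h1 : del (dlog f - dlog g) ∈ CE q := by
      rw [mem_CE, ← del_sigma, dlog_sub_dlog_sigma hμ hg0 hf0 hf hag, map_add, ← zsmul_one r,
        map_zsmul, Derivation.map_one_eq_zero, smul_zero, add_zero]
    refine not_algebraicIndependent_of_del_dlog (u := del (dlog f)) hf0 ?_ rfl
    have := add_mem (CE_le_KE h1) (del_mem_KE (dlog_mem_KE (K_le_KE hg)))
    rwa [map_sub, sub_add_cancel] at this
  · refine algebraicIndependent_nat_of_Iio fun N => ?_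
    -- A larger range than needed, since the telescoper argument requires positive length.
    have h1 : AlgebraicIndepOn (KE q) (fun n : ℕ => del^[n] f) (Set.Iio (N + 1 + 1)) := by
      by_contra h2
      exact h (exists_of_hasTelescoper hq ha ha0
        (hasTelescoper_of_not_algebraicIndepOn ha ha0 hf0 hf (N + 1) N.succ_pos h2))
    exact h1.mono (Set.Iio_subset_Iio (by omega))
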